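/- Fix $\alpha,\beta>0$. Let $AP(\mathbb R)$ be the space of Bohr almost periodic functions $f:\mathbb R\to\mathbb C$ with inner product $(f,g)_{AP}=\lim_{T\to\infty}\frac1{2T}\int_{-T}^{T}f\overline g\,dt$ and norm $\|\cdot\|_{AP}$, let $AP_2(\mathbb R)$ be its completion, and let $AP(\mathbb Z)$ be the space of almost periodic sequences $(a_n)_{n\in\mathbb Z}$ of complex numbers with inner product $(a,b)_{AP(\mathbb Z)}=\lim_{p\to\infty}\frac1{2p}\sum_{n=-p}^{p}a_n\overline{b_n}$ and the corresponding norm. Let $\ell^2(AP(\mathbb Z))$ be the space of families $a=(a^\ell)_{\ell\in\mathbb Z}$ in $AP(\mathbb Z)$ with $\|a\|^2=\sum_\ell\|a^\ell\|_{AP(\mathbb Z)}^2<\infty$. Write $e_\lambda(t)=e^{i\lambda t}$, $\tilde e_\lambda(k)=e^{i\lambda k}$, $T_x\psi(t)=\psi(t-x)$, $M_\omega\psi(t)=e^{i\omega t}\psi(t)$, $\widehat\psi(\lambda)=\int_{\mathbb R}\psi(t)e^{-i\lambda t}\,dt$ and $\langle f,g\rangle=\int_{\mathbb R}f\overline g\,dt$.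 Let $W_0$ be the space of continuous functions $g:\mathbb R\to\mathbb C$ with $\sum_{k\in\mathbb Z}\operatorname{ess\,sup}_{x\in[0,1]}|g(x-k)|<\infty$. Let $\psi\in L^1(\mathbb R)$ with $\widehat\psi\in W_0$. Then for every $a\in\ell^2(AP(\mathbb Z))$ and every $\lambda\in\mathbb R$ the series $\sum_{\ell\in\mathbb Z}\widehat\psi(\lambda-\ell\beta)\,(a^\ell,\tilde e_{\lambda\alpha})_{AP(\mathbb Z)}$ converges absolutely, there is a unique element $Ta\in AP_2(\mathbb R)$ with $$(Ta,e_\lambda)_{AP_2}=\sum_{\ell\in\mathbb Z}\widehat\psi(\lambda-\ell\beta)\,(a^\ell,\tilde e_{\lambda\alpha})_{AP(\mathbb Z)}\qquad\text{for all }\lambda\in\mathbb R,$$ and the map $T:\ell^2(AP(\mathbb Z))\to AP_2(\mathbb R)$ so defined is linear and continuous. Moreover, there is a constant $C$ such that for every $f\in AP(\mathbb R)$ all the sequences $(\langle f,T_{\alpha k}M_{\beta\ell}\psi\rangle)_{k\in\mathbb Z}$, $\ell\in\mathbb Z$, are almost periodic and $$\sum_{\ell\in\mathbb Z}\big\|(\langle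 f,T_{\alpha k}M_{\beta\ell}\psi\rangle)_{k\in\mathbb Z}\big\|_{AP(\mathbb Z)}^2\le C\,\|f\|_{AP}^2 .$$ -/

import Mathlib

open MeasureTheory Filter Topology Set
open scoped ENNReal ComplexConjugate

noncomputable section

namespace APGabor

/-! ### Almost periodic functions and sequences -/

/-- Bohr almost periodic functions on the line: continuous, and for every `ε > 0` there is `L > 0`
such that every interval of length greater than `L` contains an `ε`-almost period. -/
def IsAPFun (f : ℝ → ℂ) : Prop :=
  Continuous f ∧ ∀ ε : ℝ, 0 < ε → ∃ L : ℝ, 0 < L ∧ ∀ a b : ℝ, L < b - a →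
    ∃ τ ∈ Ioo a b, ∀ t : ℝ, ‖f (t + τ) - f t‖ ≤ ε

/-- Almost periodic sequences indexed by `ℤ`: for every `ε > 0` there is `N` such that any `N`
consecutive integers contain an `ε`-almost period. -/
def IsAPSeq (a : ℤ → ℂ) : Prop :=
  ∀ ε : ℝ, 0 < ε → ∃ N : ℕ, ∀ m : ℤ, ∃ p ∈ Ico m (m + N), ∀ n : ℤ, ‖a (n + p) - a n‖ ≤ ε

/-- The mean value `lim_{T → ∞} (2T)⁻¹ ∫_{-T}^{T} f`. -/
def meanFun (f : ℝ → ℂ) : ℂ :=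
  limUnder atTop (fun T : ℝ => ((2 * T : ℝ) : ℂ)⁻¹ * ∫ t in (-T)..T, f t)

/-- The mean value `lim_{p → ∞} (2p)⁻¹ ∑_{n = -p}^{p} a n`. -/
def meanSeq (a : ℤ → ℂ) : ℂ :=
  limUnder atTop (fun p : ℕ => ((2 * p : ℕ) : ℂ)⁻¹ * ∑ n ∈ Finset.Icc (-(p : ℤ)) p, a n)

/-! ### Auxiliary facts: total boundedness of the set of translates, existence of means -/

section Orbit

variable {G : Type*} [AddCommGroup G]

/-- The set of translates of `f` is totally bounded for the uniform distance. -/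
def OrbitTB (f : G → ℂ) : Prop :=
  ∀ ε : ℝ, 0 < ε → ∃ s : Finset G, ∀ a, ∃ b ∈ s, ∀ x, ‖f (x + a) - f (x + b)‖ ≤ ε

theorem OrbitTB.pair {f g : G → ℂ} (hf : OrbitTB f) (hg : OrbitTB g) {ε : ℝ} (hε : 0 < ε) :
    ∃ s : Finset G, ∀ a, ∃ b ∈ s, (∀ x, ‖f (x + a) - f (x + b)‖ ≤ ε) ∧
      ∀ x, ‖g (x + a) - g (x + b)‖ ≤ ε := by
  classical
  obtain ⟨s, hs⟩ := hf (ε / 2) (by positivity)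
  obtain ⟨s', hs'⟩ := hg (ε / 2) (by positivity)
  choose i hi hi' using hs
  choose j hj hj' using hs'
  set F : G → G × G := fun a => (i a, j a) with hF
  have hfin : (range F).Finite := by
    refine (s ×ˢ s').finite_toSet.subset ?_
    rintro _ ⟨a, rfl⟩
    simp [hF, hi a, hj a]
  refine ⟨hfin.toFinset.image (Function.invFun F), fun a => ⟨Function.invFun F (F a), ?_, ?_⟩⟩
  · exact Finset.mem_image_of_mem _ (by simp)
  · set b := Function.invFun F (F a) with hb
    have hFb : F b = F a := Function.invFun_eq ⟨a, rfl⟩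
    have h1 : i b = i a := congrArg Prod.fst hFb
    have h2 : j b = j a := congrArg Prod.snd hFb
    constructor
    · intro x
      have e1 := hi' a x
      have e2 := hi' b x
      rw [h1] at e2
      calc ‖f (x + a) - f (x + b)‖ = ‖(f (x + a) - f (x + i a)) - (f (x + b) - f (x + i a))‖ := by
            congr 1; ring
        _ ≤ _ := norm_sub_le _ _
        _ ≤ ε := by linarith
    · intro x
      have e1 := hj' a x
      have e2 := hj' b x
      rw [h2] at e2
      calc ‖g (x + a) - g (x + b)‖ = ‖(g (x + a) - g (x + j a)) - (g (x + b) - g (x + j a))‖ := by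
            congr 1; ring
        _ ≤ _ := norm_sub_le _ _
        _ ≤ ε := by linarith

theorem OrbitTB.bounded {f : G → ℂ} (hf : OrbitTB f) : ∃ B : ℝ, 0 ≤ B ∧ ∀ x, ‖f x‖ ≤ B := by
  obtain ⟨s, hs⟩ := hf 1 one_pos
  refine ⟨(∑ b ∈ s, ‖f b‖) + 1, by positivity, fun x => ?_⟩
  obtain ⟨b, hb, h⟩ := hs x
  have h0 := h 0
  simp only [zero_add] at h0
  have h1 : ‖f b‖ ≤ ∑ b ∈ s, ‖f b‖ :=
    Finset.single_le_sum (f := fun b => ‖f b‖) (fun _ _ => norm_nonneg _) hb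
  have h2 : ‖f x‖ ≤ ‖f x - f b‖ + ‖f b‖ := by
    simpa using norm_add_le (f x - f b) (f b)
  linarith

theorem OrbitTB.add {f g : G → ℂ} (hf : OrbitTB f) (hg : OrbitTB g) : OrbitTB (f + g) := by
  intro ε hε
  obtain ⟨s, hs⟩ := hf.pair hg (half_pos hε)
  refine ⟨s, fun a => ?_⟩
  obtain ⟨b, hb, h1, h2⟩ := hs a
  refine ⟨b, hb, fun x => ?_⟩
  calc ‖(f + g) (x + a) - (f + g) (x + b)‖
      = ‖(f (x + a) - f (x + b)) + (g (x + a) - g (x + b))‖ := by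
        simp only [Pi.add_apply]; congr 1; ring
    _ ≤ _ := norm_add_le _ _
    _ ≤ ε := by linarith [h1 x, h2 x]

theorem OrbitTB.mul {f g : G → ℂ} (hf : OrbitTB f) (hg : OrbitTB g) : OrbitTB (f * g) := by
  intro ε hε
  obtain ⟨A, hA, hfA⟩ := hf.bounded
  obtain ⟨B, hB, hgB⟩ := hg.bounded
  obtain ⟨s, hs⟩ := hf.pair hg (ε := ε / (A + B + 1)) (by positivity)
  refine ⟨s, fun a => ?_⟩
  obtain ⟨b, hb, h1, h2⟩ := hs a
  refine ⟨b, hb, fun x => ?_⟩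
  calc ‖(f * g) (x + a) - (f * g) (x + b)‖
      = ‖f (x + a) * (g (x + a) - g (x + b)) + (f (x + a) - f (x + b)) * g (x + b)‖ := by
        simp only [Pi.mul_apply]; congr 1; ring
    _ ≤ ‖f (x + a)‖ * ‖g (x + a) - g (x + b)‖ + ‖f (x + a) - f (x + b)‖ * ‖g (x + b)‖ := by
        refine (norm_add_le _ _).trans ?_
        rw [norm_mul, norm_mul]
    _ ≤ A * (ε / (A + B + 1)) + (ε / (A + B + 1)) * B := by
        gcongr
        · exact hfA _
        · exact h2 x
        · exact h1 x
        · exact hgB _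
    _ = ε * ((A + B) / (A + B + 1)) := by ring
    _ ≤ ε * 1 := by
        gcongr
        rw [div_le_one (by positivity)]
        linarith
    _ = ε := mul_one _

theorem OrbitTB.const (c : ℂ) : OrbitTB (fun _ : G => c) :=
  fun ε hε => ⟨{0}, fun _ => ⟨0, by simp, fun _ => by simpa using hε.le⟩⟩

theorem OrbitTB.conj {f : G → ℂ} (hf : OrbitTB f) : OrbitTB (fun x => conj (f x)) := by
  intro ε hε
  obtain ⟨s, hs⟩ := hf ε hε
  refine ⟨s, fun a => ?_⟩
  obtain ⟨b, hb, h⟩ := hs a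
  refine ⟨b, hb, fun x => ?_⟩
  rw [← map_sub, RCLike.norm_conj]
  exact h x

theorem OrbitTB.character {χ : G → ℂ} (hχ : ∀ x y, χ (x + y) = χ x * χ y) (h1 : ∀ x, ‖χ x‖ = 1) :
    OrbitTB χ := by
  classical
  intro ε hε
  have htb : TotallyBounded (range χ) :=
    (isCompact_closedBall (0 : ℂ) 1).totallyBounded.subset (by
      rintro _ ⟨x, rfl⟩
      simp [h1 x])
  obtain ⟨t, htr, htf, ht⟩ := (totallyBounded_iff_subset.mp htb) _ (Metric.dist_mem_uniformity hε)
  set r : ℂ → G := Function.invFun χ with hrdef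
  have hr : ∀ y ∈ t, χ (r y) = y := fun y hy => Function.invFun_eq (htr hy)
  refine ⟨htf.toFinset.image r, fun a => ?_⟩
  have ha := ht ⟨a, rfl⟩
  simp only [mem_iUnion, exists_prop] at ha
  obtain ⟨y, hy, hd⟩ := ha
  change dist (χ a) y < ε at hd
  refine ⟨r y, Finset.mem_image_of_mem _ (by simpa using hy), fun x => ?_⟩
  rw [hχ, hχ, ← mul_sub, norm_mul, h1, one_mul, hr y hy, ← dist_eq_norm]
  exact hd.le

variable [MeasurableSpace G] [MeasurableAdd₂ G] {ι : Type*} {l : Filter ι} {μ : ι → Measure G}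

theorem exists_mean [l.NeBot] (hμ : ∀ᶠ i in l, IsProbabilityMeasure (μ i))
    (hinv : ∀ f : G → ℂ, Measurable f → (∃ B : ℝ, ∀ x, ‖f x‖ ≤ B) → ∀ s,
      Tendsto (fun i => ∫ x, f (x + s) ∂μ i - ∫ x, f x ∂μ i) l (𝓝 0))
    {f : G → ℂ} (hf : OrbitTB f) (hm : Measurable f) :
    ∃ m, Tendsto (fun i => ∫ x, f x ∂μ i) l (𝓝 m) := by
  obtain ⟨B, hB, hfB⟩ := hf.bounded
  have hint : ∀ (i : ι) (_ : IsProbabilityMeasure (μ i)) (a : G),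
      Integrable (fun x => f (x + a)) (μ i) := fun i _ a =>
    Integrable.of_bound (hm.comp (measurable_add_const a)).aestronglyMeasurable B
      (Eventually.of_forall fun x => hfB _)
  have key : ∀ ε : ℝ, 0 < ε → ∀ᶠ i in l, IsProbabilityMeasure (μ i) ∧
      ∀ a, ‖∫ x, f (x + a) ∂μ i - ∫ x, f x ∂μ i‖ ≤ ε := by
    intro ε hε
    obtain ⟨s, hs⟩ := hf (ε / 2) (half_pos hε)
    have h1 : ∀ᶠ i in l, ∀ b ∈ s, ‖∫ x, f (x + b) ∂μ i - ∫ x, f x ∂μ i‖ < ε / 2 := by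
      rw [Finset.eventually_all]
      intro b _
      have := (hinv f hm ⟨B, hfB⟩ b).norm
      rw [norm_zero] at this
      exact this.eventually (gt_mem_nhds (half_pos hε))
    filter_upwards [hμ, h1] with i hi h
    refine ⟨hi, fun a => ?_⟩
    obtain ⟨b, hb, hab⟩ := hs a
    have h2 : ‖∫ x, f (x + a) ∂μ i - ∫ x, f (x + b) ∂μ i‖ ≤ ε / 2 := by
      rw [← integral_sub (hint i hi a) (hint i hi b)]
      simpa using norm_integral_le_of_norm_le_const (μ := μ i)
        (Eventually.of_forall fun x => hab x)
    calc ‖∫ x, f (x + a) ∂μ i - ∫ x, f x ∂μ i‖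
        ≤ ‖∫ x, f (x + a) ∂μ i - ∫ x, f (x + b) ∂μ i‖
          + ‖∫ x, f (x + b) ∂μ i - ∫ x, f x ∂μ i‖ := norm_sub_le_norm_sub_add_norm_sub _ _ _
      _ ≤ ε := by linarith [h b hb]
  have havg : ∀ (ε : ℝ) (i j : ι), IsProbabilityMeasure (μ i) → IsProbabilityMeasure (μ j) →
      (∀ a, ‖∫ x, f (x + a) ∂μ i - ∫ x, f x ∂μ i‖ ≤ ε) →
      ‖∫ a, ∫ x, f (x + a) ∂μ i ∂μ j - ∫ x, f x ∂μ i‖ ≤ ε := by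
    intro ε i j hi hj h
    have hmeas : StronglyMeasurable (fun a => ∫ x, f (x + a) ∂μ i) := by
      apply StronglyMeasurable.integral_prod_right (f := fun a x => f (x + a))
      exact (hm.comp (measurable_snd.add measurable_fst)).stronglyMeasurable
    have hI : Integrable (fun a => ∫ x, f (x + a) ∂μ i) (μ j) := by
      refine Integrable.of_bound hmeas.aestronglyMeasurable B (Eventually.of_forall fun a => ?_)
      simpa using norm_integral_le_of_norm_le_const (μ := μ i)
        (Eventually.of_forall fun x => hfB (x + a))
    have : ∫ a, ∫ x, f (x + a) ∂μ i ∂μ j - ∫ x, f x ∂μ i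
        = ∫ a, (∫ x, f (x + a) ∂μ i - ∫ x, f x ∂μ i) ∂μ j := by
      rw [integral_sub hI (integrable_const _)]
      simp
    rw [this]
    simpa using norm_integral_le_of_norm_le_const (μ := μ j) (Eventually.of_forall h)
  have hc : Cauchy (map (fun i => ∫ x, f x ∂μ i) l) := by
    rw [Metric.cauchy_iff]
    refine ⟨inferInstance, fun ε hε => ?_⟩
    refine ⟨_, image_mem_map (key (ε / 3) (by positivity)), ?_⟩
    rintro _ ⟨i, ⟨hi, hi'⟩, rfl⟩ _ ⟨j, ⟨hj, hj'⟩, rfl⟩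
    have e1 := havg _ i j hi hj hi'
    have e2 := havg _ j i hj hi hj'
    have hsw : ∫ a, ∫ x, f (x + a) ∂μ i ∂μ j = ∫ a, ∫ x, f (x + a) ∂μ j ∂μ i := by
      rw [integral_integral_swap]
      · simp only [add_comm]
      · refine Integrable.of_bound (Measurable.aestronglyMeasurable ?_) B
          (Eventually.of_forall fun p => hfB _)
        exact hm.comp (measurable_snd.add measurable_fst)
    rw [hsw] at e1
    rw [dist_eq_norm]
    rw [norm_sub_rev] at e1
    have := norm_sub_le_norm_sub_add_norm_sub (∫ x, f x ∂μ i)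
      (∫ a, ∫ x, f (x + a) ∂μ j ∂μ i) (∫ x, f x ∂μ j)
    linarith
  obtain ⟨m, hm⟩ := CompleteSpace.complete hc
  exact ⟨m, hm⟩

theorem eq_zero_of_mean [l.NeBot] (hμ : ∀ᶠ i in l, IsProbabilityMeasure (μ i))
    (hinv : ∀ f : G → ℂ, Measurable f → (∃ B : ℝ, ∀ x, ‖f x‖ ≤ B) → ∀ s,
      Tendsto (fun i => ∫ x, f (x + s) ∂μ i - ∫ x, f x ∂μ i) l (𝓝 0))
    {f : G → ℂ} (hf : OrbitTB f) (hm : Measurable f)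
    (h0 : Tendsto (fun i => ∫ x, conj (f x) * f x ∂μ i) l (𝓝 0)) (x₀ : G) : f x₀ = 0 := by
  by_contra hne
  have hc : 0 < ‖f x₀‖ := norm_pos_iff.mpr hne
  obtain ⟨B, hB, hfB⟩ := hf.bounded
  obtain ⟨s, hs⟩ := hf (‖f x₀‖ / 2) (half_pos hc)
  set g : G → ℂ := fun x => conj (f x) * f x with hg
  have hgm : Measurable g := (Complex.continuous_conj.measurable.comp hm).mul hm
  have hgn : ∀ x, g x = ((‖f x‖ ^ 2 : ℝ) : ℂ) := fun x => by
    simp [hg, Complex.conj_mul']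
  have hgB : ∀ x, ‖g x‖ ≤ B ^ 2 := fun x => by
    rw [hgn, Complex.norm_real, Real.norm_of_nonneg (by positivity)]
    gcongr
    exact hfB x
  have ht : Tendsto (fun i => ∑ b ∈ s, ∫ x, g (x + (x₀ - b)) ∂μ i) l (𝓝 0) := by
    have : Tendsto (fun i => ∑ b ∈ s, ∫ x, g (x + (x₀ - b)) ∂μ i) l (𝓝 (∑ b ∈ s, (0 : ℂ))) := by
      refine tendsto_finsetSum _ fun b _ => ?_
      simpa using (hinv g hgm ⟨_, hgB⟩ (x₀ - b)).add h0
    simpa using this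
  have hre : Tendsto (fun i => (∑ b ∈ s, ∫ x, g (x + (x₀ - b)) ∂μ i).re) l (𝓝 0) := by
    have := (Complex.continuous_re.tendsto 0).comp ht
    rwa [Complex.zero_re] at this
  have hge : ∀ᶠ i in l, (‖f x₀‖ / 2) ^ 2 ≤ (∑ b ∈ s, ∫ x, g (x + (x₀ - b)) ∂μ i).re := by
    filter_upwards [hμ] with i hi
    have hI : ∀ b ∈ s, Integrable (fun x => ‖f (x + (x₀ - b))‖ ^ 2) (μ i) := fun b _ => by
      refine Integrable.of_bound
        ((hm.comp (measurable_add_const _)).norm.pow_const 2).aestronglyMeasurable (B ^ 2)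
        (Eventually.of_forall fun x => ?_)
      rw [Real.norm_of_nonneg (by positivity)]
      gcongr
      exact hfB _
    have e1 : (∑ b ∈ s, ∫ x, g (x + (x₀ - b)) ∂μ i).re
        = ∫ x, ∑ b ∈ s, ‖f (x + (x₀ - b))‖ ^ 2 ∂μ i := by
      rw [integral_finsetSum _ hI, Complex.re_sum]
      refine Finset.sum_congr rfl fun b _ => ?_
      simp only [hgn]
      rw [integral_complex_ofReal, Complex.ofReal_re]
    rw [e1]
    have e2 : ∫ _x, (‖f x₀‖ / 2) ^ 2 ∂μ i = (‖f x₀‖ / 2) ^ 2 := by simp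
    rw [← e2]
    refine integral_mono (integrable_const _) (integrable_finsetSum _ hI) fun a => ?_
    obtain ⟨b, hb, h⟩ := hs a
    have h1 := h (x₀ - b)
    rw [sub_add_cancel, add_comm] at h1
    have h2 : ‖f x₀‖ / 2 ≤ ‖f (a + (x₀ - b))‖ := by
      have := norm_sub_norm_le (f x₀) (f (a + (x₀ - b)))
      rw [norm_sub_rev] at this
      linarith
    calc (‖f x₀‖ / 2) ^ 2 ≤ ‖f (a + (x₀ - b))‖ ^ 2 := by gcongr
      _ ≤ _ := Finset.single_le_sum (f := fun b => ‖f (a + (x₀ - b))‖ ^ 2)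
          (fun _ _ => by positivity) hb
  have := ge_of_tendsto hre hge
  have : 0 < (‖f x₀‖ / 2) ^ 2 := by positivity
  linarith

end Orbit

theorem IsAPFun.orbitTB {f : ℝ → ℂ} (hf : IsAPFun f) : OrbitTB f := by
  classical
  intro ε hε
  obtain ⟨hc, hap⟩ := hf
  obtain ⟨L, hL, hp⟩ := hap (ε / 4) (by positivity)
  have huc : UniformContinuousOn f (Icc (-1) (L + 2)) :=
    isCompact_Icc.uniformContinuousOn_of_continuous hc.continuousOn
  rw [Metric.uniformContinuousOn_iff] at huc
  obtain ⟨δ, hδ, hu⟩ := huc (ε / 4) (by positivity)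
  have hunif : ∀ x y : ℝ, |x - y| < min δ 1 → ‖f x - f y‖ ≤ 3 * (ε / 4) := by
    intro x y hxy
    obtain ⟨τ, hτ, h⟩ := hp (-x) (-x + (L + 1)) (by linarith)
    have h1 := h x
    have h2 := h y
    have hxy1 := lt_of_lt_of_le hxy (min_le_left _ _)
    have hxy2 := abs_lt.mp (lt_of_lt_of_le hxy (min_le_right _ _))
    have h3 := hu (x + τ) ⟨by linarith [hτ.1], by linarith [hτ.2]⟩ (y + τ)
      ⟨by linarith [hτ.1], by linarith [hτ.2]⟩ (by
        rw [Real.dist_eq]; simpa using hxy1)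
    rw [dist_eq_norm] at h3
    calc ‖f x - f y‖
        = ‖(f (x + τ) - f (y + τ)) - (f (x + τ) - f x) + (f (y + τ) - f y)‖ := by congr 1; ring
      _ ≤ ‖(f (x + τ) - f (y + τ)) - (f (x + τ) - f x)‖ + ‖f (y + τ) - f y‖ := norm_add_le _ _
      _ ≤ ‖f (x + τ) - f (y + τ)‖ + ‖f (x + τ) - f x‖ + ‖f (y + τ) - f y‖ := by
          gcongr; exact norm_sub_le _ _
      _ ≤ 3 * (ε / 4) := by linarith
  have htb : TotallyBounded (Icc 0 (L + 1)) := isCompact_Icc.totallyBounded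
  obtain ⟨t, htf, ht⟩ := Metric.totallyBounded_iff.mp htb (min δ 1) (by positivity)
  refine ⟨htf.toFinset, fun a => ?_⟩
  obtain ⟨τ, hτ, h⟩ := hp (-a) (-a + (L + 1)) (by linarith)
  have hmem := ht (show a + τ ∈ Icc 0 (L + 1) from ⟨by linarith [hτ.1], by linarith [hτ.2]⟩)
  simp only [mem_iUnion, exists_prop, Metric.mem_ball, Real.dist_eq] at hmem
  obtain ⟨b, hb, hd⟩ := hmem
  refine ⟨b, by simpa using hb, fun x => ?_⟩
  have h1 := h (x + a)
  have h2 := hunif (x + a + τ) (x + b) (by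
    rw [show x + a + τ - (x + b) = a + τ - b by ring]; exact hd)
  calc ‖f (x + a) - f (x + b)‖
      = ‖(f (x + a + τ) - f (x + b)) - (f (x + a + τ) - f (x + a))‖ := by congr 1; ring
    _ ≤ _ := norm_sub_le _ _
    _ ≤ ε := by linarith

theorem isAPFun_of_orbitTB {f : ℝ → ℂ} (hc : Continuous f) (hf : OrbitTB f) : IsAPFun f := by
  refine ⟨hc, fun ε hε => ?_⟩
  obtain ⟨s, hs⟩ := hf ε hε
  set B : ℝ := ∑ b ∈ s, |b| with hB
  have hBn : 0 ≤ B := Finset.sum_nonneg fun _ _ => abs_nonneg _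
  refine ⟨2 * B + 1, by positivity, fun a b hab => ?_⟩
  obtain ⟨c, hc, h⟩ := hs ((a + b) / 2)
  have hcB : |c| ≤ B := Finset.single_le_sum (f := fun b : ℝ => |b|) (fun _ _ => abs_nonneg _) hc
  have hcB' := abs_le.mp hcB
  refine ⟨(a + b) / 2 - c, ⟨by linarith, by linarith⟩, fun t => ?_⟩
  have := h (t - c)
  rw [sub_add_cancel] at this
  rw [show t + ((a + b) / 2 - c) = t - c + (a + b) / 2 by ring]
  exact this

theorem IsAPSeq.orbitTB {f : ℤ → ℂ} (hf : IsAPSeq f) : OrbitTB f := by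
  intro ε hε
  obtain ⟨N, hN⟩ := hf ε hε
  refine ⟨Finset.Icc 0 N, fun a => ?_⟩
  obtain ⟨p, hp, h⟩ := hN (-a)
  refine ⟨a + p, by simp only [Finset.mem_Icc]; constructor <;> linarith [hp.1, hp.2], fun x => ?_⟩
  have := h (x + a)
  rw [norm_sub_rev, ← add_assoc]
  exact this

theorem isAPSeq_of_orbitTB {f : ℤ → ℂ} (hf : OrbitTB f) : IsAPSeq f := by
  intro ε hε
  obtain ⟨s, hs⟩ := hf ε hε
  set B : ℕ := ∑ b ∈ s, b.natAbs with hB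
  refine ⟨2 * B + 1, fun m => ?_⟩
  obtain ⟨c, hc, h⟩ := hs (m + B)
  have hcB : c.natAbs ≤ B :=
    Finset.single_le_sum (f := fun b : ℤ => b.natAbs) (fun _ _ => Nat.zero_le _) hc
  refine ⟨m + B - c, ⟨by omega, by push_cast; omega⟩, fun t => ?_⟩
  have := h (t - c)
  rw [sub_add_cancel] at this
  rw [show t + (m + B - c) = t - c + (m + B) by ring]
  exact this

/-! Averaging measures on the line and on the integers. -/

/-- The normalized Lebesgue measure on `(-T, T]`. -/
def avgR (T : ℝ) : Measure ℝ := (ENNReal.ofReal (2 * T))⁻¹ • volume.restrict (Ioc (-T) T)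

theorem integral_avgR (f : ℝ → ℂ) {T : ℝ} (hT : 0 < T) :
    ∫ x, f x ∂avgR T = ((2 * T : ℝ) : ℂ)⁻¹ * ∫ t in (-T)..T, f t := by
  rw [avgR, integral_smul_measure, intervalIntegral.integral_of_le (by linarith),
    ENNReal.toReal_inv, ENNReal.toReal_ofReal (by positivity), Complex.real_smul]
  push_cast
  rfl

theorem avgR_prob : ∀ᶠ T in atTop, IsProbabilityMeasure (avgR T) := by
  filter_upwards [eventually_gt_atTop 0] with T hT
  refine ⟨?_⟩
  rw [avgR, Measure.smul_apply, Measure.restrict_apply_univ, Real.volume_Ioc, smul_eq_mul,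
    show T - -T = 2 * T by ring]
  exact ENNReal.inv_mul_cancel (by simpa using hT) ENNReal.ofReal_ne_top

theorem avgR_inv (f : ℝ → ℂ) (hf : Measurable f) (hB : ∃ B : ℝ, ∀ x, ‖f x‖ ≤ B) (s : ℝ) :
    Tendsto (fun T => ∫ x, f (x + s) ∂avgR T - ∫ x, f x ∂avgR T) atTop (𝓝 0) := by
  obtain ⟨B, hB⟩ := hB
  have hI : ∀ a b : ℝ, IntervalIntegrable f volume a b := fun a b => by
    rw [intervalIntegrable_iff]
    exact Measure.integrableOn_of_bounded (M := B) (by simp)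
      hf.aestronglyMeasurable (Eventually.of_forall hB)
  have hlim : Tendsto (fun T : ℝ => (B * |s| + B * |s|) * (2 * T)⁻¹) atTop (𝓝 0) := by
    have : Tendsto (fun T : ℝ => (2 * T)⁻¹) atTop (𝓝 0) :=
      tendsto_inv_atTop_zero.comp (tendsto_id.const_mul_atTop two_pos)
    simpa using this.const_mul (B * |s| + B * |s|)
  refine squeeze_zero_norm' ?_ hlim
  filter_upwards [eventually_gt_atTop 0] with T hT
  rw [integral_avgR _ hT, integral_avgR _ hT, ← mul_sub,
    intervalIntegral.integral_comp_add_right,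
    intervalIntegral.integral_interval_sub_interval_comm (hI _ _) (hI _ _) (hI _ _), norm_mul,
    norm_inv, Complex.norm_real, Real.norm_of_nonneg (by positivity), mul_comm]
  gcongr
  refine (norm_sub_le _ _).trans (add_le_add ?_ ?_)
  · refine (intervalIntegral.norm_integral_le_of_norm_le_const fun x _ => hB x).trans_eq ?_
    rw [show -T - (-T + s) = -s by ring, abs_neg]
  · refine (intervalIntegral.norm_integral_le_of_norm_le_const fun x _ => hB x).trans_eq ?_
    rw [show T - (T + s) = -s by ring, abs_neg]

/-- The uniform probability measure on `{-p, …, p}`. -/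
def avgZ (p : ℕ) : Measure ℤ :=
  ((2 * p + 1 : ℕ) : ℝ≥0∞)⁻¹ • ∑ n ∈ Finset.Icc (-(p : ℤ)) p, Measure.dirac n

theorem integral_avgZ (f : ℤ → ℂ) (p : ℕ) :
    ∫ x, f x ∂avgZ p = ((2 * p + 1 : ℕ) : ℂ)⁻¹ * ∑ n ∈ Finset.Icc (-(p : ℤ)) p, f n := by
  rw [avgZ, integral_smul_measure, integral_finsetSum_measure, ENNReal.toReal_inv,
    ENNReal.toReal_natCast, Complex.real_smul]
  · simp
  · intro i _
    exact integrable_dirac (by simp)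

theorem avgZ_prob (p : ℕ) : IsProbabilityMeasure (avgZ p) := by
  refine ⟨?_⟩
  have : (p : ℤ) + 1 - -p = ((2 * p + 1 : ℕ) : ℤ) := by push_cast; ring
  rw [avgZ, Measure.smul_apply, Measure.finsetSum_apply]
  simp only [measure_univ, Finset.sum_const, Int.card_Icc, this, Int.toNat_natCast, nsmul_eq_mul,
    mul_one, smul_eq_mul]
  exact ENNReal.inv_mul_cancel (by simp) (ENNReal.natCast_ne_top _)

theorem sum_shift (f : ℤ → ℂ) (p : ℕ) :
    ∑ n ∈ Finset.Icc (-(p : ℤ)) p, f (n + 1) - ∑ n ∈ Finset.Icc (-(p : ℤ)) p, f n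
      = f (p + 1) - f (-p) := by
  have h1 : ∑ n ∈ Finset.Icc (-(p : ℤ)) p, f (n + 1) = ∑ n ∈ Finset.Ioc (-(p : ℤ)) (p + 1), f n := by
    refine Finset.sum_bij (fun n _ => n + 1) ?_ ?_ ?_ ?_
    · intro n hn; simp only [Finset.mem_Icc, Finset.mem_Ioc] at *; omega
    · intro a _ b _ h; simpa using h
    · intro n hn
      refine ⟨n - 1, ?_, by ring⟩
      simp only [Finset.mem_Icc, Finset.mem_Ioc] at *; omega
    · intro n _; rfl
  have h2 : Finset.Icc (-(p : ℤ)) p = insert (-(p : ℤ)) (Finset.Ioc (-(p : ℤ)) p) := by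
    ext n; simp only [Finset.mem_Icc, Finset.mem_insert, Finset.mem_Ioc]; omega
  have h3 : Finset.Ioc (-(p : ℤ)) (p + 1) = insert ((p : ℤ) + 1) (Finset.Ioc (-(p : ℤ)) p) := by
    ext n; simp only [Finset.mem_insert, Finset.mem_Ioc]; omega
  rw [h1, h3, h2, Finset.sum_insert (by simp), Finset.sum_insert (by simp)]
  ring

theorem avgZ_inv (f : ℤ → ℂ) (_ : Measurable f) (hB : ∃ B : ℝ, ∀ x, ‖f x‖ ≤ B) (s : ℤ) :
    Tendsto (fun p => ∫ x, f (x + s) ∂avgZ p - ∫ x, f x ∂avgZ p) atTop (𝓝 0) := by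
  obtain ⟨B, hB⟩ := hB
  have step : ∀ c : ℤ,
      Tendsto (fun p => ∫ x, f (x + (c + 1)) ∂avgZ p - ∫ x, f (x + c) ∂avgZ p) atTop (𝓝 0) := by
    intro c
    have hlim : Tendsto (fun p : ℕ => (B + B) * ((p : ℝ))⁻¹) atTop (𝓝 0) := by
      simpa using (tendsto_inv_atTop_nhds_zero_nat (𝕜 := ℝ)).const_mul (B + B)
    refine squeeze_zero_norm' ?_ hlim
    filter_upwards [eventually_gt_atTop 0] with p hp
    have e : ∫ x, f (x + (c + 1)) ∂avgZ p = ∫ x, f (x + 1 + c) ∂avgZ p := by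
      congr 1; ext x; congr 1; ring
    have hBn : 0 ≤ B := (norm_nonneg _).trans (hB 0)
    rw [e, integral_avgZ (fun x => f (x + 1 + c)), integral_avgZ (fun x => f (x + c)), ← mul_sub,
      sum_shift (fun x => f (x + c)) p, norm_mul, norm_inv, Complex.norm_natCast, mul_comm]
    have hp' : (0 : ℝ) < p := by exact_mod_cast hp
    gcongr
    · exact (norm_sub_le _ _).trans (add_le_add (hB _) (hB _))
    · linarith
  induction s using Int.induction_on with
  | zero => simp
  | succ i ih => simpa using (step i).add ih
  | pred i ih =>
    have h := (step (-(i : ℤ) - 1)).neg.add ih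
    simp only [sub_add_cancel, neg_sub, neg_zero, add_zero] at h
    simpa using h

theorem IsAPFun.tendsto_mean {f : ℝ → ℂ} (hf : IsAPFun f) :
    Tendsto (fun T : ℝ => ((2 * T : ℝ) : ℂ)⁻¹ * ∫ t in (-T)..T, f t) atTop (𝓝 (meanFun f)) := by
  obtain ⟨m, hm⟩ := exists_mean avgR_prob avgR_inv hf.orbitTB hf.1.measurable
  refine tendsto_nhds_limUnder ⟨m, hm.congr' ?_⟩
  filter_upwards [eventually_gt_atTop 0] with T hT
  exact integral_avgR f hT

theorem IsAPFun.tendsto_avgR {f : ℝ → ℂ} (hf : IsAPFun f) :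
    Tendsto (fun T => ∫ x, f x ∂avgR T) atTop (𝓝 (meanFun f)) := by
  refine hf.tendsto_mean.congr' ?_
  filter_upwards [eventually_gt_atTop 0] with T hT
  exact (integral_avgR f hT).symm

theorem IsAPSeq.tendsto_mean {a : ℤ → ℂ} (ha : IsAPSeq a) :
    Tendsto (fun p : ℕ => ((2 * p : ℕ) : ℂ)⁻¹ * ∑ n ∈ Finset.Icc (-(p : ℤ)) p, a n) atTop
      (𝓝 (meanSeq a)) := by
  obtain ⟨m, hm⟩ := exists_mean (Eventually.of_forall avgZ_prob) avgZ_inv ha.orbitTB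
    (measurable_of_countable a)
  refine tendsto_nhds_limUnder ⟨m, ?_⟩
  have hr : Tendsto (fun p : ℕ => 1 + (2 : ℂ)⁻¹ * ((p : ℂ))⁻¹) atTop (𝓝 1) := by
    simpa using ((tendsto_inv_atTop_nhds_zero_nat (𝕜 := ℂ)).const_mul ((2 : ℂ)⁻¹)).const_add 1
  have := hr.mul hm
  rw [one_mul] at this
  refine this.congr' ?_
  filter_upwards [eventually_gt_atTop 0] with p hp
  have hp' : (p : ℂ) ≠ 0 := by exact_mod_cast hp.ne'
  have hp2 : (2 * p + 1 : ℂ) ≠ 0 := by exact_mod_cast (by omega : 2 * p + 1 ≠ 0)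
  rw [integral_avgZ]
  push_cast
  field_simp

theorem IsAPSeq.tendsto_avgZ {a : ℤ → ℂ} (ha : IsAPSeq a) :
    Tendsto (fun p => ∫ x, a x ∂avgZ p) atTop (𝓝 (meanSeq a)) := by
  obtain ⟨m, hm⟩ := exists_mean (Eventually.of_forall avgZ_prob) avgZ_inv ha.orbitTB
    (measurable_of_countable a)
  have hr : Tendsto (fun p : ℕ => 1 + (2 : ℂ)⁻¹ * ((p : ℂ))⁻¹) atTop (𝓝 1) := by
    simpa using ((tendsto_inv_atTop_nhds_zero_nat (𝕜 := ℂ)).const_mul ((2 : ℂ)⁻¹)).const_add 1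
  have := hr.mul hm
  rw [one_mul] at this
  have h2 : Tendsto (fun p : ℕ => ((2 * p : ℕ) : ℂ)⁻¹ * ∑ n ∈ Finset.Icc (-(p : ℤ)) p, a n) atTop
      (𝓝 m) := by
    refine this.congr' ?_
    filter_upwards [eventually_gt_atTop 0] with p hp
    have hp' : (p : ℂ) ≠ 0 := by exact_mod_cast hp.ne'
    have hp2 : (2 * p + 1 : ℂ) ≠ 0 := by exact_mod_cast (by omega : 2 * p + 1 ≠ 0)
    rw [integral_avgZ]
    push_cast
    field_simp
  rwa [tendsto_nhds_unique ha.tendsto_mean h2]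

theorem IsAPFun.add {f g : ℝ → ℂ} (hf : IsAPFun f) (hg : IsAPFun g) : IsAPFun (f + g) :=
  isAPFun_of_orbitTB (hf.1.add hg.1) (hf.orbitTB.add hg.orbitTB)

theorem IsAPFun.mul {f g : ℝ → ℂ} (hf : IsAPFun f) (hg : IsAPFun g) : IsAPFun (f * g) :=
  isAPFun_of_orbitTB (hf.1.mul hg.1) (hf.orbitTB.mul hg.orbitTB)

theorem IsAPFun.const (c : ℂ) : IsAPFun (fun _ => c) :=
  isAPFun_of_orbitTB continuous_const (OrbitTB.const c)

theorem IsAPFun.conj {f : ℝ → ℂ} (hf : IsAPFun f) : IsAPFun (fun x => conj (f x)) :=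
  isAPFun_of_orbitTB (Complex.continuous_conj.comp hf.1) hf.orbitTB.conj

theorem IsAPSeq.add {f g : ℤ → ℂ} (hf : IsAPSeq f) (hg : IsAPSeq g) : IsAPSeq (f + g) :=
  isAPSeq_of_orbitTB (hf.orbitTB.add hg.orbitTB)

theorem IsAPSeq.mul {f g : ℤ → ℂ} (hf : IsAPSeq f) (hg : IsAPSeq g) : IsAPSeq (f * g) :=
  isAPSeq_of_orbitTB (hf.orbitTB.mul hg.orbitTB)

theorem IsAPSeq.const (c : ℂ) : IsAPSeq (fun _ => c) :=
  isAPSeq_of_orbitTB (OrbitTB.const c)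

theorem IsAPSeq.conj {f : ℤ → ℂ} (hf : IsAPSeq f) : IsAPSeq (fun x => conj (f x)) :=
  isAPSeq_of_orbitTB hf.orbitTB.conj

/-! ### The pre-Hilbert spaces `AP(ℝ)`, `AP(ℤ)` and the Hilbert space `AP₂(ℝ)` -/

/-- The vector space of almost periodic functions. -/
def apFunSubmodule : Submodule ℂ (ℝ → ℂ) where
  carrier := {f | IsAPFun f}
  add_mem' hf hg := hf.add hg
  zero_mem' := IsAPFun.const 0
  smul_mem' c _ hf := (IsAPFun.const c).mul hf

/-- The vector space of almost periodic sequences. -/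
def apSeqSubmodule : Submodule ℂ (ℤ → ℂ) where
  carrier := {a | IsAPSeq a}
  add_mem' hf hg := hf.add hg
  zero_mem' := IsAPSeq.const 0
  smul_mem' c _ hf := (IsAPSeq.const c).mul hf

/-- `AP(ℝ)`; a type synonym, so that its only topology is the one of `‖·‖_AP`. -/
def APFun : Type := ↥apFunSubmodule

/-- `AP(ℤ)`; a type synonym, so that its only topology is the one of `‖·‖_{AP(ℤ)}`. -/
def APSeq : Type := ↥apSeqSubmodule

instance : AddCommGroup APFun := inferInstanceAs (AddCommGroup ↥apFunSubmodule)
instance : Module ℂ APFun := inferInstanceAs (Module ℂ ↥apFunSubmodule)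
instance : CoeFun APFun (fun _ => ℝ → ℂ) := ⟨fun f => f.1⟩
instance : AddCommGroup APSeq := inferInstanceAs (AddCommGroup ↥apSeqSubmodule)
instance : Module ℂ APSeq := inferInstanceAs (Module ℂ ↥apSeqSubmodule)
instance : CoeFun APSeq (fun _ => ℤ → ℂ) := ⟨fun a => a.1⟩

theorem APFun.isAP (f : APFun) : IsAPFun f := f.2
theorem APSeq.isAP (a : APSeq) : IsAPSeq a := a.2

theorem APFun.isAP_inner (f g : APFun) : IsAPFun (fun t => conj (f t) * g t) :=
  f.isAP.conj.mul g.isAP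

theorem APSeq.isAP_inner (a b : APSeq) : IsAPSeq (fun n => conj (a n) * b n) :=
  a.isAP.conj.mul b.isAP

/-- The inner product of `AP(ℝ)`; Mathlib's `inner ℂ f g` is conjugate linear in `f`, so it is
`(g, f)_AP = lim (2T)⁻¹ ∫_{-T}^{T} g(t) conj (f t) dt`. -/
@[reducible] def apFunCore : InnerProductSpace.Core ℂ APFun where
  inner f g := meanFun (fun t => conj (f t) * g t)
  conj_inner_symm f g := by
    have h1 := (Complex.continuous_conj.tendsto _).comp (g.isAP_inner f).tendsto_avgR
    refine tendsto_nhds_unique (h1.congr fun T => ?_) (f.isAP_inner g).tendsto_avgR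
    rw [Function.comp_apply, ← integral_conj]
    congr 1; ext t; simp [mul_comm]
  re_inner_nonneg f := by
    have h1 := (Complex.continuous_re.tendsto _).comp (f.isAP_inner f).tendsto_avgR
    refine ge_of_tendsto h1 (Eventually.of_forall fun T => ?_)
    have : ∀ t, conj (f t) * f t = ((‖f t‖ ^ 2 : ℝ) : ℂ) := fun t => by simp [Complex.conj_mul']
    simp only [Function.comp_apply, this]
    rw [integral_complex_ofReal, Complex.ofReal_re]
    exact integral_nonneg fun t => by positivity
  add_left f g h := by
    have h1 := (f.isAP_inner h).tendsto_mean.add (g.isAP_inner h).tendsto_mean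
    refine tendsto_nhds_unique ((f + g).isAP_inner h).tendsto_mean (h1.congr fun T => ?_)
    rw [← mul_add, ← intervalIntegral.integral_add
      ((f.isAP_inner h).1.intervalIntegrable _ _) ((g.isAP_inner h).1.intervalIntegrable _ _)]
    congr 2; ext t
    rw [show (f + g).1 t = f t + g t from rfl, map_add, add_mul]
  smul_left f g c := by
    have h1 := (f.isAP_inner g).tendsto_mean.const_mul (conj c)
    refine tendsto_nhds_unique ((c • f).isAP_inner g).tendsto_mean (h1.congr fun T => ?_)
    rw [mul_left_comm, ← intervalIntegral.integral_const_mul]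
    congr 2; ext t
    rw [show (c • f).1 t = c * f t from rfl, map_mul, mul_assoc]
  definite f h := by
    have h1 := (f.isAP_inner f).tendsto_avgR
    rw [h] at h1
    exact Subtype.ext (funext fun x =>
      eq_zero_of_mean avgR_prob avgR_inv f.isAP.orbitTB f.isAP.1.measurable h1 x)

/-- The inner product of `AP(ℤ)`: `inner ℂ a b = lim (2p)⁻¹ ∑_{n=-p}^{p} b_n conj (a_n)`. -/
@[reducible] def apSeqCore : InnerProductSpace.Core ℂ APSeq where
  inner a b := meanSeq (fun n => conj (a n) * b n)
  conj_inner_symm f g := by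
    have h1 := (Complex.continuous_conj.tendsto _).comp (g.isAP_inner f).tendsto_avgZ
    refine tendsto_nhds_unique (h1.congr fun T => ?_) (f.isAP_inner g).tendsto_avgZ
    rw [Function.comp_apply, ← integral_conj]
    congr 1; ext t; simp [mul_comm]
  re_inner_nonneg f := by
    have h1 := (Complex.continuous_re.tendsto _).comp (f.isAP_inner f).tendsto_avgZ
    refine ge_of_tendsto h1 (Eventually.of_forall fun T => ?_)
    have : ∀ t, conj (f t) * f t = ((‖f t‖ ^ 2 : ℝ) : ℂ) := fun t => by simp [Complex.conj_mul']
    simp only [Function.comp_apply, this]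
    rw [integral_complex_ofReal, Complex.ofReal_re]
    exact integral_nonneg fun t => by positivity
  add_left f g h := by
    have h1 := (f.isAP_inner h).tendsto_mean.add (g.isAP_inner h).tendsto_mean
    refine tendsto_nhds_unique ((f + g).isAP_inner h).tendsto_mean (h1.congr fun T => ?_)
    rw [← mul_add, ← Finset.sum_add_distrib]
    congr 2; ext t
    rw [show (f + g).1 t = f t + g t from rfl, map_add, add_mul]
  smul_left f g c := by
    have h1 := (f.isAP_inner g).tendsto_mean.const_mul (conj c)
    refine tendsto_nhds_unique ((c • f).isAP_inner g).tendsto_mean (h1.congr fun T => ?_)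
    rw [mul_left_comm, Finset.mul_sum]
    congr 2; ext t
    rw [show (c • f).1 t = c * f t from rfl, map_mul, mul_assoc]
  definite f h := by
    have h1 := (f.isAP_inner f).tendsto_avgZ
    rw [h] at h1
    exact Subtype.ext (funext fun x => eq_zero_of_mean (Eventually.of_forall avgZ_prob) avgZ_inv
      f.isAP.orbitTB (measurable_of_countable _) h1 x)

instance : NormedAddCommGroup APFun :=
  InnerProductSpace.Core.toNormedAddCommGroup (𝕜 := ℂ) (cd := apFunCore)
instance : InnerProductSpace ℂ APFun := InnerProductSpace.ofCore apFunCore.toCore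
instance : NormedAddCommGroup APSeq :=
  InnerProductSpace.Core.toNormedAddCommGroup (𝕜 := ℂ) (cd := apSeqCore)
instance : InnerProductSpace ℂ APSeq := InnerProductSpace.ofCore apSeqCore.toCore

/-- `AP₂(ℝ)`, the completion of `AP(ℝ)` for `‖·‖_AP`. -/
abbrev AP2 : Type := UniformSpace.Completion APFun

/-- `ℓ²(AP(ℤ))`. -/
abbrev ell2AP : Type := lp (fun _ : ℤ => APSeq) 2

/-- The exponential `e_λ(t) = e^{iλt}` as an element of `AP(ℝ)`. -/
def expFun (lam : ℝ) : APFun :=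
  ⟨fun t => Complex.exp (Complex.I * (lam * t : ℝ)),
    isAPFun_of_orbitTB (by fun_prop) (OrbitTB.character
      (fun x y => by rw [← Complex.exp_add]; congr 1; push_cast; ring)
      (fun x => Complex.norm_exp_I_mul_ofReal _))⟩

/-- The exponential sequence `ẽ_λ(n) = e^{iλn}` as an element of `AP(ℤ)`. -/
def expSeq (lam : ℝ) : APSeq :=
  ⟨fun n => Complex.exp (Complex.I * (lam * n : ℝ)),
    isAPSeq_of_orbitTB (OrbitTB.character (χ := fun n : ℤ => Complex.exp (Complex.I * (lam * n : ℝ)))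
      (fun x y => by rw [← Complex.exp_add]; congr 1; push_cast; ring)
      (fun x => Complex.norm_exp_I_mul_ofReal _))⟩

/-- The Fourier coefficient `(g, e_λ)` of `g ∈ AP₂(ℝ)`. -/
def coeffAP2 (g : AP2) (lam : ℝ) : ℂ := inner ℂ ((expFun lam : APFun) : AP2) g

/-- The Fourier coefficient `(a, ẽ_λ)` of `a ∈ AP(ℤ)`. -/
def coeffSeq (a : APSeq) (lam : ℝ) : ℂ := inner ℂ (expSeq lam) a

/-! ### Fourier transform, translation, modulation, Wiener space -/

/-- `ψ̂(λ) = ∫ ψ(t) e^{-iλt} dt`. -/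
def fourierL1 (ψ : ℝ → ℂ) (lam : ℝ) : ℂ :=
  ∫ t : ℝ, ψ t * Complex.exp (-(Complex.I * (lam * t : ℝ)))

/-- `T_x ψ(t) = ψ(t - x)`. -/
def translation (x : ℝ) (ψ : ℝ → ℂ) (t : ℝ) : ℂ := ψ (t - x)

/-- `M_ω ψ(t) = e^{iωt} ψ(t)`. -/
def modulation (ω : ℝ) (ψ : ℝ → ℂ) (t : ℝ) : ℂ := Complex.exp (Complex.I * (ω * t : ℝ)) * ψ t

/-- The pairing `⟨f, g⟩ = ∫ f(t) conj (g(t)) dt`. -/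
def pairing (f g : ℝ → ℂ) : ℂ := ∫ t : ℝ, f t * conj (g t)

/-- The Wiener norm `∑_{k ∈ ℤ} ess sup_{x ∈ [0,1]} |ψ(x - k)|`, with values in `[0, ∞]`. -/
def wienerNorm (ψ : ℝ → ℂ) : ℝ≥0∞ :=
  ∑' k : ℤ, essSup (fun x : ℝ => ‖ψ (x - k)‖ₑ) (volume.restrict (Icc (0 : ℝ) 1))

/-- Membership in `W₀`: continuous functions of finite Wiener norm. -/
def MemW0 (ψ : ℝ → ℂ) : Prop := Continuous ψ ∧ wienerNorm ψ < ∞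

end APGabor

end

open APGabor

/-!
The exponentials `e_λ` form a Hilbert basis of `AP₂(ℝ)` (`apBasis`), so an element of `AP₂(ℝ)` is
the same thing as a square summable family of Fourier coefficients. Everything else is an estimate
for such families.

*Completeness of the exponentials.* For `f ∈ AP(ℝ)` let `apConv f` send `v ∈ AP₂(ℝ)` to the
function `x ↦ (v, f(· - x))`. Its values are honest almost periodic functions (`apConvL`), it
commutes with translations, it is compact because the translates of `f` are totally bounded
(`isCompactOperator_apConv`), and it is self-adjoint if `f(-t) = conj (f t)`
(`isSymmetric_apConv`). Restricted to the orthogonal complement of the exponentials it cannot have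
an eigenvalue `μ ≠ 0`: the eigenspace would be a finite-dimensional translation-invariant space of
functions, and such a space contains an exponential (`exists_expFun_mem`). By the spectral theorem
`apConv f` vanishes on that complement; evaluating at `x = 0` shows that the complement is
orthogonal to every `f`, hence trivial (`eq_zero_of_inner_expFun`). Smoothing with a weight
carried by `ε`-almost periods upgrades this to Bohr's theorem on uniform approximation by
trigonometric polynomials (`exists_trigPoly_uniform`).

*Synthesis.* The samples of `φ = ψ̂ ∈ W₀` along an arithmetic progression are absolutely summable,
uniformly in the starting point (`tsum_enorm_sub_mul_le`). Put
`c(λ) = ∑_ℓ φ(λ - ℓβ) (a^ℓ, ẽ_{λα})`. The Cauchy–Schwarz inequality bounds `|c(λ)|²` by a constant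
times `∑_ℓ |φ(λ - ℓβ)| |(a^ℓ, ẽ_{λα})|²`. Summing over `λ`, first inside each class modulo `2π/α`,
where the Fourier coefficient is constant, and then over the classes with Bessel's inequality in
`AP(ℤ)`, gives `∑_λ |c(λ)|² ≤ K² ‖a‖²` (`exists_bound_synthesis`), and `T a` is the element of
`AP₂(ℝ)` with coefficients `c`.

*Analysis.* Let `f` be a trigonometric polynomial. A computation on exponentials shows that the
sequences `⟨f, T_{αk} M_{βℓ} ψ⟩` represent the adjoint of `T` applied to `f`
(`inner_sampleL_modulation`), so the sum of their squared norms is at most `‖T‖² ‖f‖²`. The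
sequences depend continuously on `f` for the uniform norm, because `ψ` is integrable; Bohr's
theorem extends the bound to all of `AP(ℝ)`.
-/

noncomputable section

namespace APGabor

/-! ### Means, translations and the orthonormal system of exponentials -/

theorem IsAPFun.norm_meanFun_le {f : ℝ → ℂ} (hf : IsAPFun f) {B : ℝ} (hB : ∀ t, ‖f t‖ ≤ B) :
    ‖meanFun f‖ ≤ B := by
  refine le_of_tendsto hf.tendsto_avgR.norm ?_
  filter_upwards [avgR_prob] with T hT
  simpa using norm_integral_le_of_norm_le_const (μ := avgR T) (Eventually.of_forall hB)

theorem IsAPSeq.norm_meanSeq_le {a : ℤ → ℂ} (ha : IsAPSeq a) {B : ℝ} (hB : ∀ t, ‖a t‖ ≤ B) :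
    ‖meanSeq a‖ ≤ B := by
  refine le_of_tendsto ha.tendsto_avgZ.norm (Eventually.of_forall fun p => ?_)
  have := avgZ_prob p
  simpa using norm_integral_le_of_norm_le_const (μ := avgZ p) (Eventually.of_forall hB)

theorem IsAPFun.translate {f : ℝ → ℂ} (hf : IsAPFun f) (s : ℝ) : IsAPFun (fun t => f (t + s)) := by
  refine ⟨hf.1.comp (continuous_add_const s), fun ε hε => ?_⟩
  obtain ⟨L, hL, h⟩ := hf.2 ε hε
  refine ⟨L, hL, fun a b hab => ?_⟩
  obtain ⟨τ, hτ, h'⟩ := h a b hab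
  refine ⟨τ, hτ, fun t => ?_⟩
  simpa only [add_right_comm] using h' (t + s)

theorem IsAPFun.reflect {f : ℝ → ℂ} (hf : IsAPFun f) : IsAPFun (fun t => f (-t)) := by
  refine isAPFun_of_orbitTB (hf.1.comp continuous_neg) fun ε hε => ?_
  classical
  obtain ⟨s, hs⟩ := hf.orbitTB ε hε
  refine ⟨s.image (- ·), fun a => ?_⟩
  obtain ⟨b, hb, h⟩ := hs (-a)
  refine ⟨-b, Finset.mem_image_of_mem _ hb, fun x => ?_⟩
  have := h (-x)
  simpa [add_comm] using this

theorem IsAPFun.meanFun_translate {f : ℝ → ℂ} (hf : IsAPFun f) (s : ℝ) :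
    meanFun (fun t => f (t + s)) = meanFun f := by
  have h := avgR_inv f hf.1.measurable
    (let ⟨B, _, hB⟩ := hf.orbitTB.bounded; ⟨B, hB⟩) s
  have h2 := h.add hf.tendsto_avgR
  simp only [sub_add_cancel, zero_add] at h2
  exact tendsto_nhds_unique (hf.translate s).tendsto_avgR h2

theorem IsAPSeq.translate {a : ℤ → ℂ} (ha : IsAPSeq a) (s : ℤ) : IsAPSeq (fun t => a (t + s)) := by
  intro ε hε
  obtain ⟨N, h⟩ := ha ε hε
  refine ⟨N, fun m => ?_⟩
  obtain ⟨τ, hτ, h'⟩ := h m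
  refine ⟨τ, hτ, fun t => ?_⟩
  simpa only [add_right_comm] using h' (t + s)

theorem IsAPSeq.meanSeq_translate {a : ℤ → ℂ} (ha : IsAPSeq a) (s : ℤ) :
    meanSeq (fun t => a (t + s)) = meanSeq a := by
  have h := avgZ_inv a (measurable_of_countable a)
    (let ⟨B, _, hB⟩ := ha.orbitTB.bounded; ⟨B, hB⟩) s
  have h2 := h.add ha.tendsto_avgZ
  simp only [sub_add_cancel, zero_add] at h2
  exact tendsto_nhds_unique (ha.translate s).tendsto_avgZ h2

/-- Almost periodic functions are uniformly continuous: only finitely many translates have to be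
controlled near the origin. -/
theorem IsAPFun.exists_delta {f : ℝ → ℂ} (hf : IsAPFun f) {ε : ℝ} (hε : 0 < ε) :
    ∀ᶠ s in 𝓝 (0 : ℝ), ∀ t, ‖f (t + s) - f t‖ ≤ ε := by
  obtain ⟨A, hA⟩ := hf.orbitTB (ε / 3) (by positivity)
  have h1 : ∀ᶠ s in 𝓝 (0 : ℝ), ∀ b ∈ A, ‖f (s + b) - f (0 + b)‖ < ε / 3 := by
    rw [Finset.eventually_all]
    intro b _
    have hc : Continuous fun s => ‖f (s + b) - f (0 + b)‖ := by
      have := hf.1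
      fun_prop
    have := hc.tendsto 0
    simp only [sub_self, norm_zero] at this
    exact this.eventually (gt_mem_nhds (by positivity))
  filter_upwards [h1] with s hs t
  obtain ⟨b, hb, h⟩ := hA t
  have e1 := h s
  have e2 := h 0
  have e3 := hs b hb
  rw [add_comm t s]
  rw [zero_add] at e2
  calc ‖f (s + t) - f t‖
      = ‖(f (s + t) - f (s + b)) + (f (s + b) - f (0 + b)) - (f t - f (0 + b))‖ := by
        congr 1; ring
    _ ≤ ‖f (s + t) - f (s + b)‖ + ‖f (s + b) - f (0 + b)‖ + ‖f t - f (0 + b)‖ :=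
        (norm_sub_le _ _).trans (by gcongr; exact norm_add_le _ _)
    _ ≤ ε := by linarith

theorem APFun.ext {f g : APFun} (h : ∀ t, f t = g t) : f = g := Subtype.ext (funext h)

theorem APSeq.ext {a b : APSeq} (h : ∀ t, a t = b t) : a = b := Subtype.ext (funext h)

@[simp] theorem APFun.add_apply (f g : APFun) (t : ℝ) : (f + g) t = f t + g t := rfl
@[simp] theorem APFun.smul_apply (c : ℂ) (f : APFun) (t : ℝ) : (c • f) t = c * f t := rfl
@[simp] theorem APFun.sub_apply (f g : APFun) (t : ℝ) : (f - g) t = f t - g t := rfl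
@[simp] theorem APSeq.smul_apply (c : ℂ) (f : APSeq) (t : ℤ) : (c • f) t = c * f t := rfl

theorem APFun.inner_eq (f g : APFun) : inner ℂ f g = meanFun (fun t => conj (f t) * g t) := rfl

theorem APSeq.inner_eq (a b : APSeq) : inner ℂ a b = meanSeq (fun t => conj (a t) * b t) := rfl

/-- The norm of `AP(ℝ)` is dominated by the supremum norm. -/
theorem APFun.norm_le {f : APFun} {B : ℝ} (hB : ∀ t, ‖f t‖ ≤ B) : ‖f‖ ≤ B := by
  have h0 : 0 ≤ B := (norm_nonneg _).trans (hB 0)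
  have h1 : ‖f‖ ^ 2 = ‖inner ℂ f f‖ := by rw [inner_self_eq_norm_sq_to_K]; simp
  refine (sq_le_sq₀ (norm_nonneg _) h0).mp ?_
  rw [h1]
  refine (f.isAP_inner f).norm_meanFun_le fun t => ?_
  rw [norm_mul, RCLike.norm_conj, ← sq]
  gcongr
  exact hB t

/-- The norm of `AP(ℤ)` is dominated by the supremum norm. -/
theorem APSeq.norm_le {f : APSeq} {B : ℝ} (hB : ∀ t, ‖f t‖ ≤ B) : ‖f‖ ≤ B := by
  have h0 : 0 ≤ B := (norm_nonneg _).trans (hB 0)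
  have h1 : ‖f‖ ^ 2 = ‖inner ℂ f f‖ := by rw [inner_self_eq_norm_sq_to_K]; simp
  refine (sq_le_sq₀ (norm_nonneg _) h0).mp ?_
  rw [h1]
  refine (f.isAP_inner f).norm_meanSeq_le fun t => ?_
  rw [norm_mul, RCLike.norm_conj, ← sq]
  gcongr
  exact hB t

/-- The translation `f ↦ f(· + s)` on `AP(ℝ)`. -/
def apTranslate (s : ℝ) : APFun →ₗ[ℂ] APFun where
  toFun f := ⟨fun t => f (t + s), f.isAP.translate s⟩
  map_add' _ _ := rfl
  map_smul' _ _ := rfl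

@[simp] theorem apTranslate_apply (s : ℝ) (f : APFun) (t : ℝ) : apTranslate s f t = f (t + s) := rfl

theorem inner_apTranslate (s : ℝ) (f g : APFun) :
    inner ℂ (apTranslate s f) (apTranslate s g) = inner ℂ f g :=
  (f.isAP_inner g).meanFun_translate s

theorem apTranslate_apTranslate (s t : ℝ) (f : APFun) :
    apTranslate s (apTranslate t f) = apTranslate (s + t) f :=
  APFun.ext fun x => by simp only [apTranslate_apply]; ring_nf

theorem apTranslate_zero (f : APFun) : apTranslate 0 f = f :=
  APFun.ext fun x => by simp

theorem norm_apTranslate (s : ℝ) (f : APFun) : ‖apTranslate s f‖ = ‖f‖ := by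
  rw [@norm_eq_sqrt_re_inner ℂ, @norm_eq_sqrt_re_inner ℂ, inner_apTranslate]

theorem expFun_apply (lam t : ℝ) : expFun lam t = Complex.exp (Complex.I * (lam * t : ℝ)) := rfl

theorem expSeq_apply (lam : ℝ) (n : ℤ) :
    expSeq lam n = Complex.exp (Complex.I * (lam * n : ℝ)) := rfl

theorem norm_expFun_apply (lam t : ℝ) : ‖expFun lam t‖ = 1 :=
  Complex.norm_exp_I_mul_ofReal _

theorem expFun_add (lam s t : ℝ) : expFun lam (s + t) = expFun lam s * expFun lam t := by
  simp only [expFun_apply]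
  rw [← Complex.exp_add]; congr 1; push_cast; ring

theorem apTranslate_expFun (lam s : ℝ) :
    apTranslate s (expFun lam) = expFun lam s • expFun lam :=
  APFun.ext fun t => by
    rw [apTranslate_apply, APFun.smul_apply, expFun_add, mul_comm]

theorem norm_expFun (lam : ℝ) : ‖expFun lam‖ = 1 := by
  have h : inner ℂ (expFun lam) (expFun lam) = (1 : ℂ) := by
    rw [APFun.inner_eq]
    have : (fun t => conj (expFun lam t) * expFun lam t) = fun _ => (1 : ℂ) := by
      ext t
      rw [Complex.conj_mul', norm_expFun_apply]
      simp
    rw [this]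
    refine tendsto_nhds_unique (IsAPFun.const 1).tendsto_avgR ?_
    refine tendsto_const_nhds.congr' ?_
    filter_upwards [avgR_prob] with T hT
    simp
  rw [@norm_eq_sqrt_re_inner ℂ, h]
  simp

theorem norm_expSeq (lam : ℝ) : ‖expSeq lam‖ = 1 := by
  have h : inner ℂ (expSeq lam) (expSeq lam) = (1 : ℂ) := by
    rw [APSeq.inner_eq]
    have : (fun t => conj (expSeq lam t) * expSeq lam t) = fun _ => (1 : ℂ) := by
      ext t
      rw [Complex.conj_mul', expSeq_apply, Complex.norm_exp_I_mul_ofReal]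
      simp
    rw [this]
    refine tendsto_nhds_unique (IsAPSeq.const 1).tendsto_avgZ ?_
    refine tendsto_const_nhds.congr fun p => ?_
    have := avgZ_prob p
    simp
  rw [@norm_eq_sqrt_re_inner ℂ, h]
  simp

theorem inner_expFun_of_ne {lam mu : ℝ} (h : lam ≠ mu) :
    inner ℂ (expFun lam) (expFun mu) = (0 : ℂ) := by
  -- translation by `s` multiplies the inner product by `exp (i (mu - lam) s) = -1`
  set s : ℝ := Real.pi / (mu - lam) with hs
  have h1 := inner_apTranslate s (expFun lam) (expFun mu)
  rw [apTranslate_expFun, apTranslate_expFun, inner_smul_left, inner_smul_right, ← mul_assoc] at h1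
  have h2 : conj (expFun lam s) * expFun mu s = -1 := by
    rw [expFun_apply, expFun_apply, ← Complex.exp_conj, ← Complex.exp_add, ← Complex.exp_pi_mul_I]
    congr 1
    have : mu - lam ≠ 0 := sub_ne_zero.mpr h.symm
    have h3 : (mu - lam) * s = Real.pi := by rw [hs]; field_simp
    rw [map_mul, Complex.conj_I, Complex.conj_ofReal, ← h3]
    push_cast; ring
  rw [h2, neg_one_mul] at h1
  exact self_eq_neg.mp h1.symm

theorem expSeq_add_two_pi (lam : ℝ) (m : ℤ) : expSeq (lam + m * (2 * Real.pi)) = expSeq lam := by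
  refine APSeq.ext fun n => ?_
  rw [expSeq_apply, expSeq_apply, Complex.exp_eq_exp_iff_exists_int]
  exact ⟨m * n, by push_cast; ring⟩

/-- The exponentials with frequencies in a half-open interval of length `2π / α`, sampled with step
`α`, are orthonormal in `AP(ℤ)`. -/
theorem orthonormal_expSeq {α : ℝ} (hα : 0 < α) :
    Orthonormal ℂ (fun θ : Ico (0 : ℝ) (2 * Real.pi / α) => expSeq (θ * α)) := by
  refine ⟨fun _ => norm_expSeq _, fun θ φ h => ?_⟩
  have hb : ∀ θ : Ico (0 : ℝ) (2 * Real.pi / α), 0 ≤ θ * α ∧ θ * α < 2 * Real.pi := fun θ =>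
    ⟨mul_nonneg θ.2.1 hα.le, (lt_div_iff₀ hα).mp θ.2.2⟩
  have hshift : ∀ lam : ℝ, ∀ t : ℤ,
      expSeq lam (t + 1) = Complex.exp (Complex.I * lam) * expSeq lam t := fun lam t => by
    rw [expSeq_apply, expSeq_apply, ← Complex.exp_add]
    congr 1; push_cast; ring
  have h1 := ((expSeq (θ * α)).isAP_inner (expSeq (φ * α))).meanSeq_translate 1
  simp only [hshift] at h1
  have h2 : (fun t => conj (Complex.exp (Complex.I * (θ * α : ℝ)) * expSeq (θ * α) t)
      * (Complex.exp (Complex.I * (φ * α : ℝ)) * expSeq (φ * α) t))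
      = fun t => conj ((Complex.exp (Complex.I * (θ * α : ℝ)) • expSeq (θ * α)) t)
        * ((Complex.exp (Complex.I * (φ * α : ℝ)) • expSeq (φ * α)) t) := rfl
  rw [h2, ← APSeq.inner_eq, ← APSeq.inner_eq, inner_smul_left, inner_smul_right, ← mul_assoc] at h1
  by_contra hne
  have h3 := mul_eq_right₀ hne |>.mp h1
  rw [← Complex.exp_conj, ← Complex.exp_add, Complex.exp_eq_one_iff] at h3
  obtain ⟨n, hn⟩ := h3
  rw [map_mul, Complex.conj_I, Complex.conj_ofReal] at hn
  have h4 : (φ * α - θ * α : ℝ) = n * (2 * Real.pi) := by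
    have h5 : Complex.I * ((φ * α - θ * α : ℝ) : ℂ)
        = Complex.I * ((n * (2 * Real.pi) : ℝ) : ℂ) := by
      push_cast at hn ⊢
      linear_combination hn
    exact_mod_cast mul_left_cancel₀ Complex.I_ne_zero h5
  have b1 := hb θ
  have b2 := hb φ
  have hpi := Real.two_pi_pos
  have n1 : (n : ℝ) < 1 := by
    by_contra hc
    push Not at hc
    nlinarith
  have n2 : (-1 : ℝ) < n := by
    by_contra hc
    push Not at hc
    nlinarith
  have n3 : n = 0 := by
    have : n < 1 := by exact_mod_cast n1
    have : -1 < n := by exact_mod_cast n2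
    omega
  rw [n3] at h4
  apply h
  ext
  have : (φ : ℝ) * α = θ * α := by simpa [sub_eq_zero] using h4
  exact (mul_right_cancel₀ hα.ne' this).symm

/-! ### Interchanging two means -/

/-- Means over `[-T, T]` converge uniformly on families that are totally bounded for the uniform
distance. -/
theorem eventually_norm_avgR_sub_meanFun_le {ι : Type*} {F : ι → ℝ → ℂ} (hF : ∀ i, IsAPFun (F i))
    (hTB : ∀ ε : ℝ, 0 < ε → ∃ s : Finset ι, ∀ i, ∃ j ∈ s, ∀ t, ‖F i t - F j t‖ ≤ ε)
    {ε : ℝ} (hε : 0 < ε) :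
    ∀ᶠ T in atTop, ∀ i, ‖∫ t, F i t ∂avgR T - meanFun (F i)‖ ≤ ε := by
  obtain ⟨s, hs⟩ := hTB (ε / 3) (by positivity)
  have h1 : ∀ᶠ T in atTop, ∀ j ∈ s, ‖∫ t, F j t ∂avgR T - meanFun (F j)‖ < ε / 3 := by
    rw [Finset.eventually_all]
    intro j _
    have := ((hF j).tendsto_avgR.sub_const (meanFun (F j))).norm
    simp only [sub_self, norm_zero] at this
    exact this.eventually (gt_mem_nhds (by positivity))
  have hint : ∀ (T : ℝ) (_ : IsProbabilityMeasure (avgR T)) (i : ι), Integrable (F i) (avgR T) := by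
    intro T hT i
    obtain ⟨B, _, hB⟩ := (hF i).orbitTB.bounded
    exact Integrable.of_bound (hF i).1.measurable.aestronglyMeasurable B (Eventually.of_forall hB)
  have hdiff : ∀ (T : ℝ) (_ : IsProbabilityMeasure (avgR T)) (i j : ι),
      (∀ t, ‖F i t - F j t‖ ≤ ε / 3) →
      ‖∫ t, F i t ∂avgR T - ∫ t, F j t ∂avgR T‖ ≤ ε / 3 := by
    intro T hT i j h
    rw [← integral_sub (hint T hT i) (hint T hT j)]
    simpa using norm_integral_le_of_norm_le_const (μ := avgR T) (Eventually.of_forall h)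
  filter_upwards [h1, avgR_prob] with T h1 hT i
  obtain ⟨j, hj, hij⟩ := hs i
  have e1 := hdiff T hT i j hij
  have e2 : ‖meanFun (F i) - meanFun (F j)‖ ≤ ε / 3 := by
    refine le_of_tendsto ((hF i).tendsto_avgR.sub (hF j).tendsto_avgR).norm ?_
    filter_upwards [avgR_prob] with S hS
    exact hdiff S hS i j hij
  have e3 := h1 j hj
  calc ‖∫ t, F i t ∂avgR T - meanFun (F i)‖
      = ‖(∫ t, F i t ∂avgR T - ∫ t, F j t ∂avgR T) + (∫ t, F j t ∂avgR T - meanFun (F j))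
          - (meanFun (F i) - meanFun (F j))‖ := by congr 1; ring
    _ ≤ _ := (norm_sub_le _ _).trans (add_le_add_left (norm_add_le _ _) _)
    _ ≤ ε := by linarith

/-- Two iterated means of a bounded continuous function of two variables agree, provided that its
sections form totally bounded families of almost periodic functions. -/
theorem meanFun_meanFun_comm {F : ℝ → ℝ → ℂ} (hc : Continuous (Function.uncurry F)) {B : ℝ}
    (hB : ∀ x y, ‖F x y‖ ≤ B)
    (h₁ : ∀ x, IsAPFun (F x)) (h₂ : ∀ y, IsAPFun fun x => F x y)
    (hA₁ : IsAPFun fun x => meanFun (F x)) (hA₂ : IsAPFun fun y => meanFun fun x => F x y)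
    (hTB₁ : ∀ ε : ℝ, 0 < ε → ∃ s : Finset ℝ, ∀ x, ∃ x' ∈ s, ∀ y, ‖F x y - F x' y‖ ≤ ε)
    (hTB₂ : ∀ ε : ℝ, 0 < ε → ∃ s : Finset ℝ, ∀ y, ∃ y' ∈ s, ∀ x, ‖F x y - F x y'‖ ≤ ε) :
    meanFun (fun x => meanFun (F x)) = meanFun fun y => meanFun fun x => F x y := by
  -- both sides are compared with the double integral over the square `[-T, T]²`
  have key : ∀ G : ℝ → ℝ → ℂ, Continuous (Function.uncurry G) → (∀ x y, ‖G x y‖ ≤ B) →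
      (∀ x, IsAPFun (G x)) → IsAPFun (fun x => meanFun (G x)) →
      (∀ ε : ℝ, 0 < ε → ∃ s : Finset ℝ, ∀ x, ∃ x' ∈ s, ∀ y, ‖G x y - G x' y‖ ≤ ε) →
      Tendsto (fun T => ∫ x, ∫ y, G x y ∂avgR T ∂avgR T) atTop
        (𝓝 (meanFun fun x => meanFun (G x))) := by
    intro G hG hGB hG1 hGA hGT
    have h0 : Tendsto (fun T => ∫ x, ∫ y, G x y ∂avgR T ∂avgR T - ∫ x, meanFun (G x) ∂avgR T) atTop
        (𝓝 0) := by
      rw [Metric.tendsto_nhds]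
      intro ε hε
      filter_upwards [eventually_norm_avgR_sub_meanFun_le hG1 hGT (half_pos hε), avgR_prob]
        with T hT hp
      have hI : Integrable (Function.uncurry G) ((avgR T).prod (avgR T)) :=
        Integrable.of_bound hG.measurable.aestronglyMeasurable B
          (Eventually.of_forall fun p => hGB _ _)
      obtain ⟨B', _, hB'⟩ := hGA.orbitTB.bounded
      have hI2 : Integrable (fun x => meanFun (G x)) (avgR T) :=
        Integrable.of_bound hGA.1.measurable.aestronglyMeasurable B' (Eventually.of_forall hB')
      have hI1 : Integrable (fun x => ∫ y, G x y ∂avgR T) (avgR T) := hI.integral_prod_left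
      rw [dist_zero_right, ← integral_sub hI1 hI2]
      refine lt_of_le_of_lt ?_ (half_lt_self hε)
      simpa using norm_integral_le_of_norm_le_const (μ := avgR T) (Eventually.of_forall hT)
    simpa using h0.add hGA.tendsto_avgR
  refine tendsto_nhds_unique (key F hc hB h₁ hA₁ hTB₁) ?_
  refine (key (fun y x => F x y) (hc.comp continuous_swap) (fun y x => hB x y)
    h₂ hA₂ hTB₂).congr' ?_
  filter_upwards [avgR_prob] with T hp
  rw [integral_integral_swap]
  exact Integrable.of_bound (hc.comp continuous_swap).measurable.aestronglyMeasurable B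
    (Eventually.of_forall fun p => hB _ _)

/-! ### The compact operators of almost periodic convolution -/

/-- The function `x ↦ (v, f(· - x))` for `f ∈ AP(ℝ)` and `v ∈ AP₂(ℝ)`, that is, the mean over `y` of
`v(y) conj (f(y - x))`. -/
def apConvFun (f : APFun) (v : AP2) (x : ℝ) : ℂ := inner ℂ ((apTranslate (-x) f : APFun) : AP2) v

theorem norm_apConvFun_le (f : APFun) (v : AP2) (x : ℝ) : ‖apConvFun f v x‖ ≤ ‖f‖ * ‖v‖ := by
  refine (norm_inner_le_norm _ _).trans_eq ?_
  rw [UniformSpace.Completion.norm_coe, norm_apTranslate]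

theorem norm_apConvFun_sub_le (f : APFun) (v : AP2) {x y ε : ℝ}
    (h : ∀ t, ‖f (-(t + x)) - f (-(t + y))‖ ≤ ε) :
    ‖apConvFun f v x - apConvFun f v y‖ ≤ ε * ‖v‖ := by
  rw [apConvFun, apConvFun, ← inner_sub_left, ← UniformSpace.Completion.coe_sub]
  refine (norm_inner_le_norm _ _).trans ?_
  rw [UniformSpace.Completion.norm_coe]
  gcongr
  refine APFun.norm_le fun t => ?_
  have := h (-t)
  rw [neg_add, neg_neg, neg_add, neg_neg] at this
  exact this

theorem isAPFun_apConvFun (f : APFun) (v : AP2) : IsAPFun (apConvFun f v) := by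
  have hr := f.isAP.reflect
  refine isAPFun_of_orbitTB ?_ fun ε hε => ?_
  · refine continuous_iff_continuousAt.mpr fun x => Metric.tendsto_nhds.mpr fun ε hε => ?_
    have h1 := hr.exists_delta (ε := ε / (‖v‖ + 1)) (by positivity)
    have h2 : Tendsto (fun y => y - x) (𝓝 x) (𝓝 0) := by
      simpa using (tendsto_id (x := 𝓝 x)).sub_const x
    filter_upwards [h2.eventually h1] with y hy
    rw [dist_eq_norm]
    refine (norm_apConvFun_sub_le f v (x := y) (y := x) (ε := ε / (‖v‖ + 1))
      fun t => ?_).trans_lt ?_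
    · have := hy (t + x)
      rwa [show t + x + (y - x) = t + y by ring] at this
    · rw [div_mul_eq_mul_div, div_lt_iff₀ (by positivity)]
      nlinarith
  · obtain ⟨s, hs⟩ := hr.orbitTB (ε / (‖v‖ + 1)) (by positivity)
    refine ⟨s, fun a => ?_⟩
    obtain ⟨b, hb, h⟩ := hs a
    refine ⟨b, hb, fun x => ?_⟩
    refine (norm_apConvFun_sub_le f v (ε := ε / (‖v‖ + 1)) fun t => ?_).trans ?_
    · rw [← add_assoc, ← add_assoc]
      exact h (t + x)
    · rw [div_mul_eq_mul_div, div_le_iff₀ (by positivity)]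
      nlinarith

/-- `v ↦ apConvFun f v` as a bounded linear map into `AP(ℝ)`: its values are functions, not merely
elements of the completion. -/
def apConvL (f : APFun) : AP2 →L[ℂ] APFun :=
  LinearMap.mkContinuous
    { toFun := fun v => ⟨apConvFun f v, isAPFun_apConvFun f v⟩
      map_add' := fun _ _ => APFun.ext fun _ => inner_add_right _ _ _
      map_smul' := fun _ _ => APFun.ext fun _ => inner_smul_right _ _ _ }
    ‖f‖ fun v => APFun.norm_le fun x => norm_apConvFun_le f v x

theorem apConvL_apply (f : APFun) (v : AP2) (x : ℝ) :
    apConvL f v x = inner ℂ ((apTranslate (-x) f : APFun) : AP2) v := rfl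

theorem inner_apTranslate_neg (x : ℝ) (f g : APFun) :
    inner ℂ (apTranslate (-x) f) g = inner ℂ f (apTranslate x g) := by
  rw [← inner_apTranslate x, apTranslate_apTranslate, add_neg_cancel, apTranslate_zero]

theorem apConvL_coe_apply (f g : APFun) (x : ℝ) :
    apConvL f g x = inner ℂ f (apTranslate x g) := by
  rw [apConvL_apply, UniformSpace.Completion.inner_coe, inner_apTranslate_neg]

theorem apConvL_expFun (f : APFun) (lam : ℝ) :
    apConvL f (expFun lam) = (inner ℂ f (expFun lam) : ℂ) • expFun lam :=
  APFun.ext fun x => by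
    rw [apConvL_coe_apply, apTranslate_expFun, inner_smul_right, APFun.smul_apply, mul_comm]

theorem apConvL_apTranslate (f g : APFun) (s : ℝ) :
    apConvL f (apTranslate s g : APFun) = apTranslate s (apConvL f g) :=
  APFun.ext fun x => by
    rw [apTranslate_apply, apConvL_coe_apply, apConvL_coe_apply, apTranslate_apTranslate]

/-- `apConvL f` as an operator on the Hilbert space `AP₂(ℝ)`. -/
def apConv (f : APFun) : AP2 →L[ℂ] AP2 := UniformSpace.Completion.toComplL ∘L apConvL f

theorem apConv_apply (f : APFun) (v : AP2) : apConv f v = (apConvL f v : APFun) := rfl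

/-- Up to a uniformly small error, `apConv f v` is determined by its values at finitely many points,
because the translates of `f` are totally bounded; so `apConv f` is compact. -/
theorem isCompactOperator_apConv (f : APFun) : IsCompactOperator (apConv f) := by
  refine (isCompactOperator_iff_isCompact_closure_image_closedBall (apConv f : AP2 →ₗ[ℂ] AP2)
    one_pos).mpr ?_
  refine TotallyBounded.isCompact_of_isClosed (TotallyBounded.closure ?_) isClosed_closure
  rw [Metric.totallyBounded_iff]
  intro ε hε
  obtain ⟨A, hA⟩ := f.isAP.reflect.orbitTB (ε / 4) (by positivity)
  set Φ : AP2 → (A → ℂ) := fun v b => apConvL f v b with hΦ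
  have htb : TotallyBounded (Φ '' Metric.closedBall 0 1) := by
    refine (isCompact_closedBall (0 : A → ℂ) ‖f‖).totallyBounded.subset ?_
    rintro _ ⟨v, hv, rfl⟩
    rw [mem_closedBall_zero_iff] at hv ⊢
    refine (pi_norm_le_iff_of_nonneg (norm_nonneg _)).mpr fun b => ?_
    refine (norm_apConvFun_le f v b).trans ?_
    nlinarith [norm_nonneg f, norm_nonneg v]
  obtain ⟨u, hus, huf, ht⟩ := exists_subset_image_finite_and.mp
    (totallyBounded_iff_subset.mp htb _ (Metric.dist_mem_uniformity (show 0 < ε / 4 by positivity)))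
  refine ⟨apConv f '' u, huf.image _, ?_⟩
  rintro _ ⟨v, hv, rfl⟩
  have hvt := ht (mem_image_of_mem Φ hv)
  simp only [mem_iUnion, mem_image, exists_prop] at hvt
  obtain ⟨_, ⟨w, hw, rfl⟩, hd⟩ := hvt
  have hd' : dist (Φ v) (Φ w) < ε / 4 := hd
  simp only [mem_iUnion, exists_prop]
  refine ⟨apConv f w, mem_image_of_mem _ hw, ?_⟩
  have hnv : ‖v‖ ≤ 1 := by simpa using hv
  have hnw : ‖w‖ ≤ 1 := by simpa using hus hw
  rw [Metric.mem_ball, dist_eq_norm]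
  change ‖apConv f v - apConv f w‖ < ε
  rw [apConv_apply, apConv_apply, ← UniformSpace.Completion.coe_sub,
    UniformSpace.Completion.norm_coe]
  refine lt_of_le_of_lt (APFun.norm_le (B := 3 * (ε / 4)) fun x => ?_) (by linarith)
  obtain ⟨b, hb, hxb⟩ := hA x
  have e1 := norm_apConvFun_sub_le f v hxb
  have e2 := norm_apConvFun_sub_le f w hxb
  have e3 : ‖apConvFun f v b - apConvFun f w b‖ ≤ ε / 4 := by
    rw [dist_eq_norm] at hd'
    exact (norm_le_pi_norm (Φ v - Φ w) ⟨b, hb⟩).trans hd'.le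
  calc ‖(apConvL f v - apConvL f w) x‖
      = ‖(apConvFun f v x - apConvFun f v b) + (apConvFun f v b - apConvFun f w b)
          - (apConvFun f w x - apConvFun f w b)‖ := by
        rw [APFun.sub_apply, show apConvL f v x = apConvFun f v x from rfl,
          show apConvL f w x = apConvFun f w x from rfl]
        congr 1; ring
    _ ≤ _ := (norm_sub_le _ _).trans (add_le_add_left (norm_add_le _ _) _)
    _ ≤ 3 * (ε / 4) := by nlinarith

/-- The symmetry of `apConvL f` on `AP(ℝ)` is the interchange of two means. -/
theorem inner_apConvL_symm {f : APFun} (hf : ∀ t, f (-t) = conj (f t)) (g h : APFun) :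
    inner ℂ (apConvL f g) h = inner ℂ g (apConvL f h) := by
  obtain ⟨Bf, hBf0, hBf⟩ := f.isAP.orbitTB.bounded
  obtain ⟨Bg, hBg0, hBg⟩ := g.isAP.orbitTB.bounded
  obtain ⟨Bh, hBh0, hBh⟩ := h.isAP.orbitTB.bounded
  have hfc := f.isAP.1
  have hgc := g.isAP.1
  have hhc := h.isAP.1
  set F : ℝ → ℝ → ℂ := fun x y => conj (g x) * (conj (f (y - x)) * h y) with hF
  have hsub : ∀ x, IsAPFun fun y => conj (f (y - x)) := fun x => by
    simpa only [sub_eq_add_neg] using (f.isAP.translate (-x)).conj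
  have hsub' : ∀ y, IsAPFun fun x => conj (f (y - x)) := fun y => by
    have := (f.isAP.translate y).reflect.conj
    refine (congrArg IsAPFun (funext fun x => ?_)).mp this
    rw [neg_add_eq_sub]
  have e1 : ∀ x, meanFun (F x) = conj (g x) * apConvL f h x := fun x => by
    rw [apConvL_apply, UniformSpace.Completion.inner_coe, APFun.inner_eq]
    refine tendsto_nhds_unique
      (IsAPFun.tendsto_avgR ((IsAPFun.const _).mul ((hsub x).mul h.isAP))) ?_
    have := (((apTranslate (-x) f).isAP_inner h).tendsto_avgR).const_mul (conj (g x))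
    refine this.congr fun T => ?_
    rw [← integral_const_mul]
    simp only [hF, apTranslate_apply, sub_eq_add_neg]
  have e2 : ∀ y, meanFun (fun x => F x y) = conj (apConvL f g y) * h y := fun y => by
    rw [apConvL_apply, UniformSpace.Completion.inner_coe, inner_conj_symm, APFun.inner_eq]
    refine tendsto_nhds_unique
      (IsAPFun.tendsto_avgR (g.isAP.conj.mul ((hsub' y).mul (IsAPFun.const _)))) ?_
    have := ((g.isAP_inner (apTranslate (-y) f)).tendsto_avgR).mul_const (h y)
    refine this.congr fun T => ?_
    rw [← integral_mul_const]
    refine integral_congr_ae (Eventually.of_forall fun x => ?_)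
    simp only [hF, apTranslate_apply, ← sub_eq_add_neg]
    rw [← hf, neg_sub, mul_assoc]
  rw [APFun.inner_eq, APFun.inner_eq]
  simp only [← e1, ← e2]
  symm
  refine meanFun_meanFun_comm (B := Bg * (Bf * Bh)) ?_ ?_ ?_ ?_ ?_ ?_ ?_ ?_
  · simp only [hF, Function.uncurry_def]
    have := Complex.continuous_conj
    fun_prop
  · intro x y
    simp only [hF, norm_mul, RCLike.norm_conj]
    gcongr
    exacts [hBg _, hBf _, hBh _]
  · exact fun x => (IsAPFun.const _).mul ((hsub x).mul h.isAP)
  · exact fun y => g.isAP.conj.mul ((hsub' y).mul (IsAPFun.const _))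
  · simp only [e1]
    exact g.isAP_inner (apConvL f h)
  · simp only [e2]
    exact (apConvL f g).isAP_inner h
  · intro ε hε
    obtain ⟨s, hs⟩ := g.isAP.orbitTB.pair f.isAP.reflect.orbitTB
      (ε := ε / ((Bf + Bg) * Bh + 1)) (by positivity)
    refine ⟨s, fun x => ?_⟩
    obtain ⟨b, hb, h1, h2⟩ := hs x
    refine ⟨b, hb, fun y => ?_⟩
    have h1' := h1 0
    have h2' := h2 (-y)
    rw [zero_add, zero_add] at h1'
    rw [neg_add, neg_neg, neg_add, neg_neg, ← sub_eq_add_neg, ← sub_eq_add_neg] at h2'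
    calc ‖F x y - F b y‖
        = ‖(conj (g x - g b) * conj (f (y - x)) + conj (g b) * conj (f (y - x) - f (y - b)))
            * h y‖ := by
          simp only [hF, map_sub]; congr 1; ring
      _ ≤ (ε / ((Bf + Bg) * Bh + 1) * Bf + Bg * (ε / ((Bf + Bg) * Bh + 1))) * Bh := by
          rw [norm_mul]
          gcongr
          · refine (norm_add_le _ _).trans ?_
            simp only [norm_mul, RCLike.norm_conj]
            gcongr
            exacts [hBf _, hBg _]
          · exact hBh _
      _ = ε * (((Bf + Bg) * Bh) / ((Bf + Bg) * Bh + 1)) := by ring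
      _ ≤ ε * 1 := by
          gcongr
          rw [div_le_one (by positivity)]
          linarith
      _ = ε := mul_one _
  · intro ε hε
    obtain ⟨s, hs⟩ := h.isAP.orbitTB.pair f.isAP.orbitTB
      (ε := ε / ((Bf + Bh) * Bg + 1)) (by positivity)
    refine ⟨s, fun x => ?_⟩
    obtain ⟨b, hb, h1, h2⟩ := hs x
    refine ⟨b, hb, fun y => ?_⟩
    have h1' := h1 0
    have h2' := h2 (-y)
    rw [zero_add, zero_add] at h1'
    rw [neg_add_eq_sub, neg_add_eq_sub] at h2'
    calc ‖F y x - F y b‖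
        = ‖conj (g y) * (conj (f (x - y) - f (b - y)) * h b + conj (f (x - y)) * (h x - h b))‖ := by
          simp only [hF, map_sub]; congr 1; ring
      _ ≤ Bg * (ε / ((Bf + Bh) * Bg + 1) * Bh + Bf * (ε / ((Bf + Bh) * Bg + 1))) := by
          rw [norm_mul, RCLike.norm_conj]
          gcongr
          · exact hBg _
          · refine (norm_add_le _ _).trans ?_
            simp only [norm_mul, RCLike.norm_conj]
            gcongr
            exacts [hBh _, hBf _]
      _ = ε * (((Bf + Bh) * Bg) / ((Bf + Bh) * Bg + 1)) := by ring
      _ ≤ ε * 1 := by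
          gcongr
          rw [div_le_one (by positivity)]
          linarith
      _ = ε := mul_one _

theorem isSymmetric_apConv {f : APFun} (hf : ∀ t, f (-t) = conj (f t)) :
    (apConv f).IsSymmetric := by
  intro v w
  change inner ℂ (apConv f v) w = inner ℂ v (apConv f w)
  induction v, w using UniformSpace.Completion.induction_on₂ with
  | hp => exact isClosed_eq (by fun_prop) (by fun_prop)
  | ih g h =>
    rw [apConv_apply, apConv_apply, UniformSpace.Completion.inner_coe,
      UniformSpace.Completion.inner_coe, inner_apConvL_symm hf]

/-! ### Finite-dimensional translation-invariant spaces -/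

/-- A bounded continuous character of the line is an exponential: it is differentiable because it is
a multiple of its own moving average, and it solves a linear differential equation. -/
theorem exists_eq_exp_of_map_add {χ : ℝ → ℂ} (hc : Continuous χ) (h0 : χ 0 = 1)
    (hadd : ∀ x y, χ (x + y) = χ x * χ y) {B : ℝ} (hB : ∀ x, ‖χ x‖ ≤ B) :
    ∃ lam : ℝ, ∀ t, χ t = Complex.exp (Complex.I * (lam * t : ℝ)) := by
  have hΦ : ∀ x, HasDerivAt (fun x => ∫ t in (0 : ℝ)..x, χ t) (χ x) x := fun x =>
    intervalIntegral.integral_hasDerivAt_right (hc.intervalIntegrable _ _)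
      hc.stronglyMeasurable.stronglyMeasurableAtFilter hc.continuousAt
  obtain ⟨a, ha⟩ : ∃ a : ℝ, ∫ t in (0 : ℝ)..a, χ t ≠ 0 := by
    by_contra! hne
    have h1 := hΦ 0
    simp only [hne] at h1
    have := h1.unique (hasDerivAt_const (0 : ℝ) (0 : ℂ))
    rw [h0] at this
    exact one_ne_zero this
  set J := ∫ t in (0 : ℝ)..a, χ t with hJ
  have hχ : ∀ x, χ x = J⁻¹ * ((∫ t in (0 : ℝ)..(x + a), χ t) - ∫ t in (0 : ℝ)..x, χ t) := by
    intro x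
    rw [intervalIntegral.integral_interval_sub_left (hc.intervalIntegrable _ _)
      (hc.intervalIntegrable _ _)]
    have h1 : ∫ t in x..(x + a), χ t = χ x * J := by
      have := intervalIntegral.integral_comp_add_left (f := χ) (a := 0) (b := a) x
      rw [add_zero] at this
      rw [← this, hJ, ← intervalIntegral.integral_const_mul]
      simp only [hadd]
    rw [h1]
    field_simp
  set c : ℂ := J⁻¹ * (χ a - 1) with hcdef
  have hderiv : ∀ x, HasDerivAt χ (c * χ x) x := by
    intro x
    have h1 : HasDerivAt (fun x => J⁻¹ * ((∫ t in (0 : ℝ)..(x + a), χ t) - ∫ t in (0 : ℝ)..x, χ t))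
        (J⁻¹ * (χ (x + a) - χ x)) x :=
      (((hΦ (x + a)).comp_add_const x a).sub (hΦ x)).const_mul _
    rw [← funext hχ] at h1
    convert h1 using 1
    rw [hcdef, hadd]
    ring
  have hexp : ∀ x : ℝ, χ x = Complex.exp (c * x) := by
    have hd : ∀ x : ℝ, HasDerivAt (fun x : ℝ => χ x * Complex.exp (-(c * x))) 0 x := by
      intro x
      have h1 : HasDerivAt (fun x : ℝ => -(c * (x : ℂ))) (-(c * 1)) x :=
        (((hasDerivAt_id x).ofReal_comp).const_mul c).neg
      refine ((hderiv x).mul h1.cexp).congr_deriv ?_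
      ring
    have hconst := is_const_of_deriv_eq_zero (fun x => (hd x).differentiableAt)
      (fun x => (hd x).deriv)
    intro x
    have h1 := hconst x 0
    simp only [h0, Complex.ofReal_zero, mul_zero, neg_zero, Complex.exp_zero, mul_one] at h1
    rw [Complex.exp_neg] at h1
    field_simp at h1
    exact h1
  have hre : c.re = 0 := by
    by_contra hne
    -- at `B / c.re` the modulus is `exp B > B`
    have h1 := hB (B / c.re)
    rw [hexp, Complex.norm_exp, Complex.re_mul_ofReal, mul_div_cancel₀ _ hne] at h1
    linarith [Real.add_one_le_exp B]
  refine ⟨c.im, fun t => ?_⟩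
  rw [hexp]
  congr 1
  apply Complex.ext <;> simp [hre]

/-- A nonzero finite-dimensional translation-invariant space of almost periodic functions contains
an exponential: translations commute, so they have a common eigenfunction, whose eigenvalues form a
bounded continuous character of the line. -/
theorem exists_expFun_mem (E : Submodule ℂ APFun) [FiniteDimensional ℂ E] (hE : E ≠ ⊥)
    (hinv : ∀ s, ∀ f ∈ E, apTranslate s f ∈ E) : ∃ lam, expFun lam ∈ E := by
  classical
  -- on an invariant subspace of minimal dimension every translation is a scalar
  have hex : ∃ n : ℕ, ∃ W : Submodule ℂ APFun, W ≤ E ∧ W ≠ ⊥ ∧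
      (∀ s, ∀ f ∈ W, apTranslate s f ∈ W) ∧ Module.finrank ℂ W = n :=
    ⟨_, E, le_rfl, hE, hinv, rfl⟩
  obtain ⟨W, hWE, hW0, hWinv, hWn⟩ := Nat.find_spec hex
  have hfin : FiniteDimensional ℂ W := Submodule.finiteDimensional_of_le hWE
  have hnt : Nontrivial W := Submodule.nontrivial_iff_ne_bot.mpr hW0
  have hscalar : ∀ s, ∃ μ : ℂ, ∀ f ∈ W, apTranslate s f = μ • f := by
    intro s
    obtain ⟨μ, hμ⟩ := Module.End.exists_eigenvalue ((apTranslate s).restrict (hWinv s))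
    obtain ⟨v, hv⟩ := hμ.exists_hasEigenvector
    have hv1 : apTranslate s v = μ • (v : APFun) := congrArg Subtype.val hv.apply_eq_smul
    refine ⟨μ, fun f hf => ?_⟩
    set W' : Submodule ℂ APFun := W ⊓ LinearMap.ker (apTranslate s - μ • LinearMap.id) with hW'
    have hmem : ∀ g, g ∈ W' ↔ g ∈ W ∧ apTranslate s g = μ • g := fun g => by
      rw [hW', Submodule.mem_inf, LinearMap.mem_ker, LinearMap.sub_apply, LinearMap.smul_apply,
        LinearMap.id_apply, sub_eq_zero]
    have hW'0 : W' ≠ ⊥ := by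
      rw [Submodule.ne_bot_iff]
      exact ⟨v, (hmem _).mpr ⟨v.2, hv1⟩, fun h => hv.2 (Subtype.ext h)⟩
    have hle : W' ≤ W := inf_le_left
    have heq : W' = W := by
      refine Submodule.eq_of_le_of_finrank_le hle ?_
      rw [hWn]
      refine Nat.find_min' hex ⟨W', hle.trans hWE, hW'0, fun t g hg => ?_, rfl⟩
      obtain ⟨hg1, hg2⟩ := (hmem g).mp hg
      refine (hmem _).mpr ⟨hWinv t g hg1, ?_⟩
      rw [apTranslate_apTranslate, add_comm, ← apTranslate_apTranslate, hg2, map_smul]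
    rw [← heq] at hf
    exact ((hmem f).mp hf).2
  choose μ hμ using hscalar
  obtain ⟨f, hfW, hf0⟩ := Submodule.exists_mem_ne_zero_of_ne_bot hW0
  obtain ⟨x₀, hx₀⟩ : ∃ x, f x ≠ 0 := by
    by_contra! h
    exact hf0 (APFun.ext h)
  set g : APFun := (f x₀)⁻¹ • apTranslate x₀ f with hg
  have hgW : g ∈ W := W.smul_mem _ (hWinv _ _ hfW)
  have hg0 : g 0 = 1 := by
    rw [hg, APFun.smul_apply, apTranslate_apply, zero_add, inv_mul_cancel₀ hx₀]
  have hgμ : ∀ s x, g (x + s) = μ s * g x := fun s x =>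
    congrFun (congrArg Subtype.val (hμ s g hgW)) x
  have hμg : ∀ s, μ s = g s := fun s => by
    have := hgμ s 0
    rw [zero_add, hg0, mul_one] at this
    exact this.symm
  obtain ⟨B, _, hB⟩ := g.isAP.orbitTB.bounded
  obtain ⟨lam, hlam⟩ := exists_eq_exp_of_map_add g.isAP.1 hg0
    (fun x y => by rw [hgμ, hμg, mul_comm]) hB
  have : expFun lam = g := APFun.ext fun t => (hlam t).symm
  exact ⟨lam, hWE (this ▸ hgW)⟩

/-! ### Completeness of the exponentials and uniform approximation -/

/-- The function `t ↦ conj (f (-t))`. -/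
def conjReflect (f : APFun) : APFun := ⟨fun t => conj (f (-t)), f.isAP.reflect.conj⟩

theorem inner_expFun_apConv_eq_zero {f : APFun} (hf : ∀ t, f (-t) = conj (f t)) {w : AP2}
    (hw : ∀ lam, inner ℂ ((expFun lam : APFun) : AP2) w = 0) (lam : ℝ) :
    inner ℂ ((expFun lam : APFun) : AP2) (apConv f w) = 0 := by
  have hs : ∀ u v : AP2, inner ℂ (apConv f u) v = inner ℂ u (apConv f v) := isSymmetric_apConv hf
  rw [← hs, apConv_apply, apConvL_expFun, UniformSpace.Completion.coe_smul, inner_smul_left, hw,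
    mul_zero]

/-- On the orthogonal complement of the exponentials the compact self-adjoint operator `apConv f`
has no eigenvalue other than zero, since an eigenspace would be a finite-dimensional
translation-invariant space of functions and so contain an exponential. -/
theorem apConv_eq_zero_of_orthogonal {f : APFun} (hf : ∀ t, f (-t) = conj (f t)) {w : AP2}
    (hw : ∀ lam, inner ℂ ((expFun lam : APFun) : AP2) w = 0) : apConv f w = 0 := by
  set N : Submodule ℂ AP2 :=
    (Submodule.span ℂ (range fun lam => ((expFun lam : APFun) : AP2)))ᗮ with hN
  have hmem : ∀ v, v ∈ N ↔ ∀ lam, inner ℂ ((expFun lam : APFun) : AP2) v = 0 := by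
    intro v
    refine ⟨fun hv lam => hv _ (Submodule.subset_span ⟨lam, rfl⟩), fun hv u hu => ?_⟩
    induction hu using Submodule.span_induction with
    | mem x hx => obtain ⟨lam, rfl⟩ := hx; exact hv lam
    | zero => exact inner_zero_left _
    | add x y _ _ hx hy => rw [inner_add_left, hx, hy, add_zero]
    | smul c x _ hx => rw [inner_smul_left, hx, mul_zero]
  have hNinv : ∀ v ∈ N, apConv f v ∈ N := fun v hv =>
    (hmem _).mpr (inner_expFun_apConv_eq_zero hf ((hmem v).mp hv))
  set S : N →L[ℂ] N := (apConv f).restrict hNinv with hS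
  have hScomp : IsCompactOperator S := (isCompactOperator_apConv f).restrict' hNinv
  have hSsymm : S.IsSymmetric := (isSymmetric_apConv hf).restrict_invariant hNinv
  have hS0 : S = 0 := by
    rw [← ContinuousLinearMap.eq_zero_of_forall_hasEigenvalue_eq_zero hScomp hSsymm]
    intro μ hμ
    by_contra hμ0
    obtain ⟨v, hv⟩ := hμ.exists_hasEigenvector
    have hv1 : apConv f v = μ • (v : AP2) := congrArg Subtype.val hv.apply_eq_smul
    set P : Submodule ℂ AP2 := Module.End.eigenspace (apConv f).toLinearMap μ with hP
    have hPmem : ∀ u, u ∈ P ↔ apConv f u = μ • u := fun u => Module.End.mem_eigenspace_iff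
    have hPfin : FiniteDimensional ℂ P :=
      ContinuousLinearMap.finite_dimensional_eigenspace (isCompactOperator_apConv f) μ hμ0
    set ι : APFun →ₗ[ℂ] AP2 := (UniformSpace.Completion.toComplL : APFun →L[ℂ] AP2).toLinearMap
      with hι
    have hιinj : Function.Injective ι := UniformSpace.Completion.coe_injective APFun
    set E : Submodule ℂ APFun := (N ⊓ P).comap ι with hE
    have hEmem : ∀ h : APFun, h ∈ E ↔
        (∀ lam, inner ℂ (expFun lam) h = (0 : ℂ)) ∧ apConvL f h = μ • h := by
      intro h
      rw [hE, Submodule.mem_comap, Submodule.mem_inf, hmem, hPmem]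
      refine and_congr (forall_congr' fun lam => ?_) ?_
      · change inner ℂ ((expFun lam : APFun) : AP2) (h : AP2) = 0 ↔ _
        rw [UniformSpace.Completion.inner_coe]
      · change ((apConvL f h : APFun) : AP2) = μ • (h : AP2) ↔ _
        rw [← UniformSpace.Completion.coe_smul]
        exact (UniformSpace.Completion.coe_injective APFun).eq_iff
    have hEfin : FiniteDimensional ℂ E := by
      have hmap : ∀ h : E, (ι ∘ₗ E.subtype) h ∈ P := fun h => (Submodule.mem_inf.mp h.2).2
      refine FiniteDimensional.of_injective ((ι ∘ₗ E.subtype).codRestrict P hmap) fun x y hxy => ?_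
      exact Subtype.ext (hιinj (congrArg Subtype.val hxy))
    have hE0 : E ≠ ⊥ := by
      -- an eigenvector with nonzero eigenvalue lies in the range of `apConvL f`
      have hcoe : ι (μ⁻¹ • apConvL f v) = v := by
        rw [map_smul]
        change μ⁻¹ • apConv f v = v
        rw [hv1, inv_smul_smul₀ hμ0]
      rw [Submodule.ne_bot_iff]
      refine ⟨μ⁻¹ • apConvL f v, ?_, fun h => hv.2 (Subtype.ext ?_)⟩
      · rw [hE, Submodule.mem_comap, hcoe]
        exact ⟨v.2, (hPmem _).mpr hv1⟩
      · rw [h, map_zero] at hcoe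
        exact hcoe.symm
    obtain ⟨lam, hlam⟩ := exists_expFun_mem E hE0 fun s h hh => by
      obtain ⟨h1, h2⟩ := (hEmem h).mp hh
      refine (hEmem _).mpr ⟨fun lam => ?_, ?_⟩
      · rw [← inner_apTranslate_neg, apTranslate_expFun, inner_smul_left, h1, mul_zero]
      · rw [apConvL_apTranslate, h2, map_smul]
    have h1 := ((hEmem _).mp hlam).1 lam
    rw [inner_self_eq_zero] at h1
    have h2 := norm_expFun lam
    rw [h1, norm_zero] at h2
    exact zero_ne_one h2
  exact congrArg Subtype.val (congrArg (fun A : N →L[ℂ] N => A ⟨w, (hmem w).mpr hw⟩) hS0)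

/-- The exponentials are complete in `AP₂(ℝ)`. The operators `apConv f` with `f(-t) = conj (f t)`
vanish at `w`; evaluation at the origin gives `(w, f) = 0` for such `f`, and every element of
`AP(ℝ)` is a combination of two of them. -/
theorem eq_zero_of_inner_expFun {w : AP2}
    (hw : ∀ lam, inner ℂ ((expFun lam : APFun) : AP2) w = 0) : w = 0 := by
  have hsymm : ∀ f : APFun, (∀ t, f (-t) = conj (f t)) → inner ℂ (f : AP2) w = 0 := by
    intro f hf
    have h1 := apConv_eq_zero_of_orthogonal hf hw
    rw [apConv_apply, ← UniformSpace.Completion.coe_zero] at h1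
    have h2 := UniformSpace.Completion.coe_injective APFun h1
    have h3 := apConvL_apply f w 0
    rw [neg_zero, apTranslate_zero, h2] at h3
    exact h3.symm
  have hall : ∀ f : APFun, inner ℂ (f : AP2) w = 0 := by
    intro f
    have h1 : ∀ t, conjReflect f t = conj (f (-t)) := fun _ => rfl
    have e1 := hsymm (f + conjReflect f) fun t => by simp [h1, add_comm]
    have e2 := hsymm (Complex.I • (f - conjReflect f)) fun t => by
      simp only [APFun.smul_apply, APFun.sub_apply, h1, map_mul, map_sub, Complex.conj_I,
        Complex.conj_conj, neg_neg]
      ring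
    rw [UniformSpace.Completion.coe_add, inner_add_left] at e1
    rw [UniformSpace.Completion.coe_smul, UniformSpace.Completion.coe_sub, inner_smul_left,
      inner_sub_left, Complex.conj_I] at e2
    have e3 := (mul_eq_zero.mp e2).resolve_left (by simp)
    linear_combination (1 / 2 : ℂ) * e1 + (1 / 2 : ℂ) * e3
  rw [← inner_self_eq_zero (𝕜 := ℂ)]
  have hcl : ∀ u : AP2, inner ℂ u w = 0 := fun u => by
    induction u using UniformSpace.Completion.induction_on with
    | hp => exact isClosed_eq (by fun_prop) continuous_const
    | ih f => exact hall f
  exact hcl w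

theorem orthonormal_coe_expFun : Orthonormal ℂ fun lam => ((expFun lam : APFun) : AP2) :=
  ⟨fun lam => by rw [UniformSpace.Completion.norm_coe, norm_expFun],
    fun lam mu h => by
      change inner ℂ ((expFun lam : APFun) : AP2) ((expFun mu : APFun) : AP2) = 0
      rw [UniformSpace.Completion.inner_coe, inner_expFun_of_ne h]⟩

/-- The exponentials form a Hilbert basis of `AP₂(ℝ)`. -/
def apBasis : HilbertBasis ℝ ℂ AP2 :=
  HilbertBasis.mkOfOrthogonalEqBot orthonormal_coe_expFun <| by
    refine (Submodule.eq_bot_iff _).mpr fun w hw => eq_zero_of_inner_expFun fun lam => ?_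
    exact hw _ (Submodule.subset_span ⟨lam, rfl⟩)

theorem apBasis_apply (lam : ℝ) : apBasis lam = ((expFun lam : APFun) : AP2) := by
  rw [apBasis, HilbertBasis.coe_mkOfOrthogonalEqBot]

theorem apBasis_repr_apply (g : AP2) (lam : ℝ) : apBasis.repr g lam = coeffAP2 g lam := by
  rw [HilbertBasis.repr_apply_apply, apBasis_apply, coeffAP2]

/-- The space of trigonometric polynomials, the linear span of the exponentials in `AP(ℝ)`. -/
def trigPoly : Submodule ℂ APFun := Submodule.span ℂ (range expFun)

theorem exists_trigPoly_norm_sub_lt (f : APFun) {ε : ℝ} (hε : 0 < ε) :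
    ∃ p ∈ trigPoly, ‖f - p‖ < ε := by
  have h1 := apBasis.dense_span
  have h2 : (f : AP2) ∈ (Submodule.span ℂ (range apBasis)).topologicalClosure := by
    rw [h1]; trivial
  obtain ⟨q, hq, hd⟩ := Metric.mem_closure_iff.mp h2 ε hε
  set ι : APFun →ₗ[ℂ] AP2 := (UniformSpace.Completion.toComplL : APFun →L[ℂ] AP2).toLinearMap
  have h3 : Submodule.span ℂ (range apBasis) = trigPoly.map ι := by
    rw [trigPoly, Submodule.map_span, ← range_comp]
    congr 2
    ext1 lam
    exact apBasis_apply lam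
  rw [SetLike.mem_coe, h3] at hq
  obtain ⟨p, hp, rfl⟩ := hq
  refine ⟨p, hp, ?_⟩
  rw [dist_eq_norm] at hd
  rwa [← UniformSpace.Completion.norm_coe, UniformSpace.Completion.coe_sub]

theorem IsAPFun.norm_meanFun_le_re {g : ℝ → ℂ} (hg : IsAPFun g) {r : ℝ → ℝ}
    (hr : IsAPFun fun t => (r t : ℂ)) (h : ∀ t, ‖g t‖ ≤ r t) :
    ‖meanFun g‖ ≤ (meanFun fun t => (r t : ℂ)).re := by
  have h2 := (Complex.continuous_re.tendsto _).comp hr.tendsto_avgR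
  refine le_of_tendsto_of_tendsto hg.tendsto_avgR.norm h2 ?_
  filter_upwards [avgR_prob] with T hT
  have hrc : Continuous r := by
    have := Complex.continuous_re.comp hr.1
    simpa [Function.comp_def] using this
  obtain ⟨B, _, hB⟩ := hr.orbitTB.bounded
  have hI : Integrable r (avgR T) :=
    Integrable.of_bound hrc.measurable.aestronglyMeasurable B
      (Eventually.of_forall fun t => by simpa using hB t)
  rw [Function.comp_apply, integral_complex_ofReal, Complex.ofReal_re]
  exact norm_integral_le_of_norm_le hI (Eventually.of_forall h)

/-- The uniform distance between `f` and its translate by `y`. -/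
def translateDist (f : APFun) (y : ℝ) : ℝ := ⨆ x, ‖f (x + y) - f x‖

theorem bddAbove_translateDist (f : APFun) (y : ℝ) :
    BddAbove (range fun x => ‖f (x + y) - f x‖) := by
  obtain ⟨B, _, hB⟩ := f.isAP.orbitTB.bounded
  refine ⟨B + B, ?_⟩
  rintro _ ⟨x, rfl⟩
  exact (norm_sub_le _ _).trans (add_le_add (hB _) (hB _))

theorem le_translateDist (f : APFun) (x y : ℝ) : ‖f (x + y) - f x‖ ≤ translateDist f y :=
  le_ciSup (bddAbove_translateDist f y) x

theorem translateDist_zero (f : APFun) : translateDist f 0 = 0 := by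
  simp [translateDist]

theorem abs_translateDist_sub_le (f : APFun) {y z ε : ℝ} (h : ∀ x, ‖f (x + y) - f (x + z)‖ ≤ ε) :
    |translateDist f y - translateDist f z| ≤ ε := by
  have key : ∀ y z : ℝ, (∀ x, ‖f (x + y) - f (x + z)‖ ≤ ε) →
      translateDist f y ≤ translateDist f z + ε := by
    intro y z h
    refine ciSup_le fun x => ?_
    calc ‖f (x + y) - f x‖ = ‖(f (x + z) - f x) + (f (x + y) - f (x + z))‖ := by congr 1; ring
      _ ≤ _ := norm_add_le _ _
      _ ≤ translateDist f z + ε := add_le_add (le_translateDist f x z) (h x)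
  have h1 := key y z h
  have h2 := key z y fun x => by rw [norm_sub_rev]; exact h x
  rw [abs_le]
  constructor <;> linarith

/-- The cut-off of `translateDist f`, supported on the `ε`-almost periods of `f`, inherits almost
periodicity from `f`. -/
theorem isAPFun_bump (f : APFun) (ε : ℝ) :
    IsAPFun fun y => ((max 0 (ε - translateDist f y) : ℝ) : ℂ) := by
  have key : ∀ {y z δ : ℝ}, (∀ x, ‖f (x + y) - f (x + z)‖ ≤ δ) →
      ‖((max 0 (ε - translateDist f y) : ℝ) : ℂ) - ((max 0 (ε - translateDist f z) : ℝ) : ℂ)‖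
        ≤ δ := by
    intro y z δ h
    rw [← Complex.ofReal_sub, Complex.norm_real, Real.norm_eq_abs]
    simp only [max_comm (0 : ℝ)]
    refine (abs_max_sub_max_le_abs _ _ _).trans ?_
    rw [sub_sub_sub_cancel_left, abs_sub_comm]
    exact abs_translateDist_sub_le f h
  refine isAPFun_of_orbitTB ?_ fun δ hδ => ?_
  · refine continuous_iff_continuousAt.mpr fun x => Metric.tendsto_nhds.mpr fun δ hδ => ?_
    have h2 : Tendsto (fun y => y - x) (𝓝 x) (𝓝 0) := by
      simpa using (tendsto_id (x := 𝓝 x)).sub_const x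
    filter_upwards [h2.eventually (f.isAP.exists_delta (half_pos hδ))] with y hy
    rw [dist_eq_norm]
    refine (key fun t => ?_).trans_lt (half_lt_self hδ)
    have := hy (t + x)
    rwa [show t + x + (y - x) = t + y by ring] at this
  · obtain ⟨s, hs⟩ := f.isAP.orbitTB δ hδ
    refine ⟨s, fun a => ?_⟩
    obtain ⟨b, hb, h⟩ := hs a
    refine ⟨b, hb, fun x => key fun t => ?_⟩
    rw [← add_assoc, ← add_assoc]
    exact h (t + x)

/-- **Bohr's approximation theorem**: almost periodic functions are uniform limits of trigonometric
polynomials. Averaging the translates of `f` against a weight supported on `ε / 2`-almost periods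
changes `f` by at most `ε / 2`, and turns approximation in mean into uniform approximation. -/
theorem exists_trigPoly_uniform (f : APFun) {ε : ℝ} (hε : 0 < ε) :
    ∃ p ∈ trigPoly, ∀ t, ‖f t - p t‖ ≤ ε := by
  set r : ℝ → ℝ := fun y => max 0 (ε / 2 - translateDist f y) with hr
  set u : APFun := ⟨fun y => (r y : ℂ), isAPFun_bump f _⟩ with hu
  have hwAP : IsAPFun fun y => ((r y ^ 2 : ℝ) : ℂ) := by
    refine (congrArg IsAPFun (funext fun y => ?_)).mp (u.isAP.mul u.isAP)
    simp only [hu, Pi.mul_apply]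
    push_cast; ring
  set w : APFun := ⟨_, hwAP⟩ with hw
  have hw_apply : ∀ y, w y = ((r y ^ 2 : ℝ) : ℂ) := fun _ => rfl
  have hu0 : u ≠ 0 := by
    intro h
    have h1 : u 0 = 0 := by rw [h]; rfl
    have h2 : u 0 = ((ε / 2 : ℝ) : ℂ) := by
      change ((max 0 (ε / 2 - translateDist f 0) : ℝ) : ℂ) = _
      rw [translateDist_zero, sub_zero, max_eq_right (by positivity)]
    rw [h2, Complex.ofReal_eq_zero] at h1
    linarith
  set m : ℝ := ‖u‖ ^ 2 with hm
  have hm0 : 0 < m := by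
    have := norm_pos_iff.mpr hu0
    positivity
  have hmean : meanFun (fun y => ((r y ^ 2 : ℝ) : ℂ)) = m := by
    have h1 : inner ℂ u u = ((m : ℝ) : ℂ) := by
      rw [inner_self_eq_norm_sq_to_K, hm]
      push_cast; rfl
    rw [← h1, APFun.inner_eq]
    congr 1
    ext y
    simp only [hu, Complex.conj_ofReal]
    push_cast; ring
  have hsmall : ∀ x, ‖apConvL w f x - m * f x‖ ≤ ε / 2 * m := by
    intro x
    have hwf : IsAPFun fun y => conj (w y) * (apTranslate x f - f x • expFun 0) y :=
      w.isAP_inner _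
    have e1 : apConvL w f x - m * f x
        = meanFun fun y => conj (w y) * (apTranslate x f - f x • expFun 0) y := by
      rw [← APFun.inner_eq, inner_sub_right, inner_smul_right, apConvL_coe_apply]
      have : inner ℂ w (expFun 0) = (m : ℂ) := by
        rw [APFun.inner_eq, ← hmean]
        congr 1; ext y
        rw [hw_apply, Complex.conj_ofReal, expFun_apply]
        simp
      rw [this]; ring
    rw [e1]
    have hscaled : IsAPFun fun y => ((ε / 2 * r y ^ 2 : ℝ) : ℂ) := by
      refine (congrArg IsAPFun (funext fun y => ?_)).mp ((IsAPFun.const ((ε / 2 : ℝ) : ℂ)).mul hwAP)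
      simp only [Pi.mul_apply]
      push_cast; ring
    refine (hwf.norm_meanFun_le_re hscaled fun y => ?_).trans_eq ?_
    · have e2 : (apTranslate x f - f x • expFun 0) y = f (x + y) - f x := by
        rw [APFun.sub_apply, apTranslate_apply, APFun.smul_apply, expFun_apply, add_comm]
        simp
      rw [e2, norm_mul, RCLike.norm_conj, hw_apply, Complex.norm_real,
        Real.norm_of_nonneg (by positivity), mul_comm]
      by_cases hy : translateDist f y ≤ ε / 2
      · gcongr
        exact (le_translateDist f x y).trans hy
      · have : r y = 0 := max_eq_left (by linarith)
        simp [this]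
    · have e3 : (fun y => ((ε / 2 * r y ^ 2 : ℝ) : ℂ))
          = fun y => conj ((((ε / 2 : ℝ) : ℂ) • expFun 0) y) * w y := by
        ext y
        rw [APFun.smul_apply, map_mul, Complex.conj_ofReal, expFun_apply, hw_apply]
        simp
      have e4 : inner ℂ (expFun 0) w = (m : ℂ) := by
        rw [APFun.inner_eq, ← hmean]
        congr 1; ext y
        rw [hw_apply, expFun_apply]
        simp
      rw [e3, ← APFun.inner_eq, inner_smul_left, e4, Complex.conj_ofReal, ← Complex.ofReal_mul,
        Complex.ofReal_re]
  obtain ⟨p, hp, hfp⟩ := exists_trigPoly_norm_sub_lt f (ε := ε / 2 * m / (‖w‖ + 1)) (by positivity)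
  have hK : ∀ q ∈ trigPoly, apConvL w (q : AP2) ∈ trigPoly := by
    intro q hq
    induction hq using Submodule.span_induction with
    | mem x hx =>
      obtain ⟨lam, rfl⟩ := hx
      rw [apConvL_expFun]
      exact trigPoly.smul_mem _ (Submodule.subset_span ⟨lam, rfl⟩)
    | zero =>
      rw [UniformSpace.Completion.coe_zero, map_zero]
      exact trigPoly.zero_mem
    | add x y _ _ hx hy =>
      rw [UniformSpace.Completion.coe_add, map_add]
      exact trigPoly.add_mem hx hy
    | smul c x _ hx =>
      rw [UniformSpace.Completion.coe_smul, map_smul]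
      exact trigPoly.smul_mem _ hx
  refine ⟨(m : ℂ)⁻¹ • apConvL w (p : AP2), trigPoly.smul_mem _ (hK p hp), fun t => ?_⟩
  have hclose : ‖apConvL w f t - apConvL w p t‖ ≤ ε / 2 * m := by
    rw [← APFun.sub_apply, ← map_sub, ← UniformSpace.Completion.coe_sub]
    refine (norm_apConvFun_le w _ t).trans ?_
    rw [UniformSpace.Completion.norm_coe]
    calc ‖w‖ * ‖f - p‖ ≤ (‖w‖ + 1) * (ε / 2 * m / (‖w‖ + 1)) := by
          gcongr
          linarith
      _ = ε / 2 * m := by field_simp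
  have hmC : (m : ℂ) ≠ 0 := by exact_mod_cast hm0.ne'
  have e5 : f t - ((m : ℂ)⁻¹ • apConvL w (p : AP2)) t
      = (m : ℂ)⁻¹ * ((apConvL w f t - apConvL w p t) - (apConvL w f t - m * f t)) := by
    rw [APFun.smul_apply]
    field_simp
    ring
  rw [e5, norm_mul, norm_inv, Complex.norm_real, Real.norm_of_nonneg hm0.le,
    inv_mul_le_iff₀ hm0]
  refine (norm_sub_le _ _).trans ?_
  linarith [hsmall t]

/-! ### Sampled sums of functions in the Wiener space -/

/-- For a continuous function the essential supremum over the unit interval bounds every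
value there. -/
theorem enorm_sub_intCast_le_essSup {φ : ℝ → ℂ} (hφ : Continuous φ) (k : ℤ) {x : ℝ}
    (hx : x ∈ Icc (0 : ℝ) 1) :
    ‖φ (x - k)‖ₑ ≤ essSup (fun x : ℝ => ‖φ (x - k)‖ₑ) (volume.restrict (Icc (0 : ℝ) 1)) := by
  set S := essSup (fun x : ℝ => ‖φ (x - k)‖ₑ) (volume.restrict (Icc (0 : ℝ) 1)) with hS
  have hc : Continuous fun x : ℝ => ‖φ (x - k)‖ₑ := by fun_prop
  have hae : ∀ᵐ x ∂(volume.restrict (Icc (0 : ℝ) 1)), ‖φ (x - k)‖ₑ ≤ S := ENNReal.ae_le_essSup _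
  have hclosed : IsClosed {x : ℝ | ‖φ (x - k)‖ₑ ≤ S} := isClosed_le hc continuous_const
  have hsub : Ioo (0 : ℝ) 1 ⊆ {x : ℝ | ‖φ (x - k)‖ₑ ≤ S} := by
    have hopen : IsOpen (Ioo (0 : ℝ) 1 ∩ {x : ℝ | ‖φ (x - k)‖ₑ ≤ S}ᶜ) :=
      isOpen_Ioo.inter hclosed.isOpen_compl
    have hnull : volume (Ioo (0 : ℝ) 1 ∩ {x : ℝ | ‖φ (x - k)‖ₑ ≤ S}ᶜ) = 0 := by
      have h1 : (volume.restrict (Icc (0 : ℝ) 1)) {x : ℝ | ‖φ (x - k)‖ₑ ≤ S}ᶜ = 0 := hae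
      rw [Measure.restrict_apply hclosed.isOpen_compl.measurableSet, inter_comm] at h1
      exact measure_mono_null (inter_subset_inter_left _ Ioo_subset_Icc_self) h1
    have hempty := (hopen.measure_eq_zero_iff volume).mp hnull
    intro y hy
    by_contra hne
    exact (hempty ▸ (⟨hy, hne⟩ : y ∈ Ioo (0 : ℝ) 1 ∩ {x : ℝ | ‖φ (x - k)‖ₑ ≤ S}ᶜ) : y ∈ (∅ : Set ℝ))
  have := closure_minimal hsub hclosed
  rw [closure_Ioo (zero_ne_one)] at this
  exact this hx

/-- At most `⌈1 / c⌉ + 1` points of a progression of step `c` fall into a half-open unit interval,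
so the samples of `φ` along it are summable, uniformly in the starting point. -/
theorem tsum_enorm_sub_mul_le {φ : ℝ → ℂ} (hφ : Continuous φ) {c : ℝ} (hc : 0 < c) (x : ℝ) :
    ∑' n : ℤ, ‖φ (x - n * c)‖ₑ ≤ ((⌈1 / c⌉₊ + 1 : ℕ) : ℝ≥0∞) * wienerNorm φ := by
  classical
  set S : ℤ → ℝ≥0∞ := fun k =>
    essSup (fun x : ℝ => ‖φ (x - k)‖ₑ) (volume.restrict (Icc (0 : ℝ) 1)) with hS
  set κ : ℤ → ℤ := fun n => -⌊x - n * c⌋ with hκ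
  have h1 : ∀ n : ℤ, ‖φ (x - n * c)‖ₑ ≤ ∑' j : ℤ, if j = κ n then S j else 0 := by
    intro n
    rw [tsum_ite_eq]
    have h2 := enorm_sub_intCast_le_essSup hφ (κ n) (x := Int.fract (x - n * c))
      ⟨Int.fract_nonneg _, (Int.fract_lt_one _).le⟩
    have h3 : Int.fract (x - n * c) - (κ n : ℝ) = x - n * c := by
      rw [hκ, Int.fract]; push_cast; ring
    rwa [h3] at h2
  refine (ENNReal.tsum_le_tsum h1).trans ?_
  rw [ENNReal.tsum_comm, wienerNorm, ← ENNReal.tsum_mul_left]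
  refine ENNReal.tsum_le_tsum fun j => ?_
  set F : Finset ℤ := Finset.Ioc ⌊(x + j - 1) / c⌋ ⌊(x + j) / c⌋ with hF
  have hmem : ∀ n : ℤ, j = κ n → n ∈ F := by
    intro n hn
    have h4 : ⌊x - n * c⌋ = -j := by rw [hn]; simp [hκ]
    rw [Int.floor_eq_iff] at h4
    push_cast at h4
    rw [hF, Finset.mem_Ioc, Int.floor_lt, Int.le_floor, div_lt_iff₀ hc, le_div_iff₀ hc]
    constructor <;> linarith [h4.1, h4.2]
  have hcard : F.card ≤ ⌈1 / c⌉₊ + 1 := by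
    rw [hF, Int.card_Ioc, Int.toNat_le]
    have h5 : ((⌊(x + j) / c⌋ - ⌊(x + j - 1) / c⌋ : ℤ) : ℝ) < ((⌈1 / c⌉₊ + 1 : ℕ) : ℝ) := by
      have e1 := Int.floor_le ((x + j) / c)
      have e2 := Int.lt_floor_add_one ((x + j - 1) / c)
      have e3 := Nat.le_ceil (1 / c)
      have e4 : (x + j) / c = (x + j - 1) / c + 1 / c := by ring
      push_cast
      linarith
    exact_mod_cast h5.le
  rw [tsum_eq_sum (s := F) fun n hn => if_neg fun h => hn (hmem n h)]
  calc ∑ n ∈ F, (if j = κ n then S j else 0) ≤ ∑ _n ∈ F, S j := by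
        refine Finset.sum_le_sum fun n _ => ?_
        split_ifs
        exacts [le_rfl, zero_le]
    _ = (F.card : ℝ≥0∞) * S j := by rw [Finset.sum_const, nsmul_eq_mul]
    _ ≤ _ := by gcongr

theorem exists_bound_samples {φ : ℝ → ℂ} (hφ : MemW0 φ) {c : ℝ} (hc : 0 < c) :
    ∃ A : ℝ, 0 ≤ A ∧ ∀ x : ℝ, ∑' n : ℤ, ‖φ (x - n * c)‖ₑ ≤ ENNReal.ofReal A := by
  refine ⟨(((⌈1 / c⌉₊ + 1 : ℕ) : ℝ≥0∞) * wienerNorm φ).toReal, ENNReal.toReal_nonneg, fun x => ?_⟩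
  rw [ENNReal.ofReal_toReal (ENNReal.mul_ne_top (ENNReal.natCast_ne_top _) hφ.2.ne)]
  exact tsum_enorm_sub_mul_le hφ.1 hc x

/-! ### The synthesis operator -/

theorem tsum_enorm_sq_le_iff {ι E : Type*} [NormedAddCommGroup E] {x : ι → E} {B : ℝ}
    (hB : 0 ≤ B) :
    ∑' i, ‖x i‖ₑ ^ 2 ≤ ENNReal.ofReal B ^ 2 ↔ ∀ s : Finset ι, ∑ i ∈ s, ‖x i‖ ^ 2 ≤ B ^ 2 := by
  rw [ENNReal.tsum_eq_iSup_sum, iSup_le_iff]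
  refine forall_congr' fun s => ?_
  have h1 : ∑ i ∈ s, ‖x i‖ₑ ^ 2 = ENNReal.ofReal (∑ i ∈ s, ‖x i‖ ^ 2) := by
    rw [ENNReal.ofReal_sum_of_nonneg fun i _ => by positivity]
    refine Finset.sum_congr rfl fun i _ => ?_
    rw [ENNReal.ofReal_pow (norm_nonneg _), ofReal_norm]
  rw [h1, ← ENNReal.ofReal_pow hB, ENNReal.ofReal_le_ofReal_iff (by positivity)]

/-- The Cauchy–Schwarz inequality for a weighted sum. -/
theorem enorm_sq_le_of_hasSum_mul {ι : Type*} {p b : ι → ℂ} {c : ℂ}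
    (h : HasSum (fun i => p i * b i) c) :
    ‖c‖ₑ ^ 2 ≤ (∑' i, ‖p i‖ₑ) * ∑' i, ‖p i‖ₑ * ‖b i‖ₑ ^ 2 := by
  have hc : Tendsto (fun s : Finset ι => ‖∑ i ∈ s, p i * b i‖ₑ ^ 2) atTop (𝓝 (‖c‖ₑ ^ 2)) :=
    (ENNReal.continuous_pow 2).continuousAt.tendsto.comp
      (continuous_enorm.continuousAt.tendsto.comp h)
  refine le_of_tendsto hc (Eventually.of_forall fun s => ?_)
  have h1 : ‖∑ i ∈ s, p i * b i‖₊ ^ 2 ≤ (∑ i ∈ s, ‖p i‖₊) * ∑ i ∈ s, ‖p i‖₊ * ‖b i‖₊ ^ 2 := by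
    calc ‖∑ i ∈ s, p i * b i‖₊ ^ 2 ≤ (∑ i ∈ s, ‖p i‖₊ * ‖b i‖₊) ^ 2 := by
          gcongr
          refine (nnnorm_sum_le _ _).trans_eq (Finset.sum_congr rfl fun i _ => nnnorm_mul _ _)
      _ ≤ _ := Finset.sum_sq_le_sum_mul_sum_of_sq_le_mul _ (fun _ _ => zero_le)
          (fun _ _ => zero_le) fun i _ => le_of_eq (by ring)
  calc ‖∑ i ∈ s, p i * b i‖ₑ ^ 2 = ((‖∑ i ∈ s, p i * b i‖₊ ^ 2 : NNReal) : ℝ≥0∞) := by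
        rw [ENNReal.coe_pow, enorm_eq_nnnorm]
    _ ≤ (((∑ i ∈ s, ‖p i‖₊) * ∑ i ∈ s, ‖p i‖₊ * ‖b i‖₊ ^ 2 : NNReal) : ℝ≥0∞) := by
        exact_mod_cast h1
    _ = (∑ i ∈ s, ‖p i‖ₑ) * ∑ i ∈ s, ‖p i‖ₑ * ‖b i‖ₑ ^ 2 := by
        push_cast
        simp only [enorm_eq_nnnorm]
    _ ≤ _ := by gcongr <;> exact ENNReal.sum_le_tsum _

theorem norm_coeffSeq_le (a : APSeq) (lam : ℝ) : ‖coeffSeq a lam‖ ≤ ‖a‖ := by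
  refine (norm_inner_le_norm _ _).trans_eq ?_
  rw [norm_expSeq, one_mul]

theorem coeffSeq_add_two_pi (a : APSeq) (lam : ℝ) (m : ℤ) :
    coeffSeq a (lam + m * (2 * Real.pi)) = coeffSeq a lam := by
  rw [coeffSeq, expSeq_add_two_pi, coeffSeq]

/-- Bessel's inequality in `AP(ℤ)`, weighted with samples of `φ`. The frequencies `lam` are split
into classes modulo `2π / α`, on which the Fourier coefficient is constant. -/
theorem tsum_enorm_mul_coeffSeq_le {φ : ℝ → ℂ} {α : ℝ} (hα : 0 < α) {A : ℝ}
    (hA : ∀ x : ℝ, ∑' n : ℤ, ‖φ (x - n * (2 * Real.pi / α))‖ₑ ≤ ENNReal.ofReal A)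
    (a : APSeq) (y : ℝ) :
    ∑' lam : ℝ, ‖φ (lam - y)‖ₑ * ‖coeffSeq a (lam * α)‖ₑ ^ 2 ≤ ENNReal.ofReal A * ‖a‖ₑ ^ 2 := by
  set P : ℝ := 2 * Real.pi / α with hP
  have hP0 : 0 < P := div_pos Real.two_pi_pos hα
  set e : ℝ → Ico (0 : ℝ) P × ℤ := fun lam =>
    (⟨toIcoMod hP0 0 lam, by simpa using toIcoMod_mem_Ico hP0 0 lam⟩, toIcoDiv hP0 0 lam) with he
  have hdecomp : ∀ lam : ℝ, ((e lam).1 : ℝ) + (e lam).2 * P = lam := fun lam => by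
    have := toIcoMod_add_toIcoDiv_zsmul hP0 0 lam
    rwa [zsmul_eq_mul] at this
  have hinj : Function.Injective e := fun x y hxy => by rw [← hdecomp x, ← hdecomp y, hxy]
  set G : Ico (0 : ℝ) P × ℤ → ℝ≥0∞ := fun q =>
    ‖φ ((q.1 : ℝ) + q.2 * P - y)‖ₑ * ‖coeffSeq a (q.1 * α)‖ₑ ^ 2 with hG
  have hfe : ∀ lam : ℝ, ‖φ (lam - y)‖ₑ * ‖coeffSeq a (lam * α)‖ₑ ^ 2 = G (e lam) := fun lam => by
    have h1 : lam * α = (e lam).1 * α + (e lam).2 * (2 * Real.pi) := by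
      have h2 : P * α = 2 * Real.pi := by rw [hP]; field_simp
      rw [← h2]
      nth_rewrite 1 [← hdecomp lam]
      ring
    simp only [hG]
    rw [hdecomp, h1, coeffSeq_add_two_pi]
  simp only [hfe]
  refine (ENNReal.tsum_comp_le_tsum_of_injective hinj G).trans ?_
  rw [ENNReal.tsum_prod']
  have hrow : ∀ θ : Ico (0 : ℝ) P,
      ∑' m : ℤ, G (θ, m) ≤ ENNReal.ofReal A * ‖coeffSeq a (θ * α)‖ₑ ^ 2 := fun θ => by
    simp only [hG]
    rw [ENNReal.tsum_mul_right]
    gcongr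
    rw [← (Equiv.neg ℤ).tsum_eq]
    refine le_of_eq_of_le (tsum_congr fun m => ?_) (hA (θ - y))
    rw [Equiv.neg_apply]
    congr 2
    push_cast; ring
  refine (ENNReal.tsum_le_tsum hrow).trans ?_
  rw [ENNReal.tsum_mul_left]
  gcongr
  rw [← ofReal_norm a, tsum_enorm_sq_le_iff (norm_nonneg _)]
  exact fun s => (orthonormal_expSeq hα).sum_inner_products_le a

theorem tsum_enorm_sq_lp_le (a : ell2AP) : ∑' l : ℤ, ‖a l‖ₑ ^ 2 ≤ ENNReal.ofReal ‖a‖ ^ 2 := by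
  rw [tsum_enorm_sq_le_iff (norm_nonneg _)]
  intro s
  have := lp.sum_rpow_le_norm_rpow (p := 2) (by simp) a s
  simpa using this

theorem summable_synthesis {α β : ℝ} {φ : ℝ → ℂ} (hβ : 0 < β) (hφ : MemW0 φ) (a : ell2AP)
    (lam : ℝ) : Summable fun l : ℤ => φ (lam - l * β) * coeffSeq (a l) (lam * α) := by
  obtain ⟨A, _, hA⟩ := exists_bound_samples hφ hβ
  have h1 : Summable fun l : ℤ => ‖φ (lam - l * β)‖ := by
    have : ∑' n : ℤ, ‖φ (lam - n * β)‖ₑ ≠ ∞ := ((hA lam).trans_lt ENNReal.ofReal_lt_top).ne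
    have h2 := ENNReal.summable_toReal this
    simpa using h2
  refine Summable.of_norm_bounded (h1.mul_right ‖a‖) fun l => ?_
  rw [norm_mul]
  gcongr
  exact (norm_coeffSeq_le _ _).trans (lp.norm_apply_le_norm (by simp) a l)

/-- The family `c(lam)` of prescribed Fourier coefficients is square summable over all real `lam`,
with norm controlled by `‖a‖`. -/
theorem exists_bound_synthesis {α β : ℝ} {φ : ℝ → ℂ} (hα : 0 < α) (hβ : 0 < β)
    (hφ : MemW0 φ) :
    ∃ K : ℝ, 0 ≤ K ∧ ∀ (a : ell2AP) (s : Finset ℝ),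
      ∑ lam ∈ s, ‖∑' l : ℤ, φ (lam - l * β) * coeffSeq (a l) (lam * α)‖ ^ 2 ≤ (K * ‖a‖) ^ 2 := by
  obtain ⟨A, hA0, hA⟩ := exists_bound_samples hφ hβ
  obtain ⟨B, hB0, hB⟩ := exists_bound_samples hφ (div_pos Real.two_pi_pos hα)
  refine ⟨√(A * B), Real.sqrt_nonneg _, fun a => ?_⟩
  rw [← tsum_enorm_sq_le_iff (by positivity)]
  calc ∑' lam : ℝ, ‖∑' l : ℤ, φ (lam - l * β) * coeffSeq (a l) (lam * α)‖ₑ ^ 2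
      ≤ ∑' lam : ℝ, ENNReal.ofReal A *
          ∑' l : ℤ, ‖φ (lam - l * β)‖ₑ * ‖coeffSeq (a l) (lam * α)‖ₑ ^ 2 := by
        refine ENNReal.tsum_le_tsum fun lam => ?_
        refine (enorm_sq_le_of_hasSum_mul (summable_synthesis hβ hφ a lam).hasSum).trans ?_
        gcongr
        exact hA lam
    _ = ENNReal.ofReal A *
          ∑' l : ℤ, ∑' lam : ℝ, ‖φ (lam - l * β)‖ₑ * ‖coeffSeq (a l) (lam * α)‖ₑ ^ 2 := by
        rw [ENNReal.tsum_mul_left, ENNReal.tsum_comm]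
    _ ≤ ENNReal.ofReal A * ∑' l : ℤ, ENNReal.ofReal B * ‖a l‖ₑ ^ 2 := by
        gcongr with l
        exact tsum_enorm_mul_coeffSeq_le hα hB (a l) _
    _ ≤ ENNReal.ofReal A * (ENNReal.ofReal B * ENNReal.ofReal ‖a‖ ^ 2) := by
        rw [ENNReal.tsum_mul_left]
        gcongr
        exact tsum_enorm_sq_lp_le a
    _ = ENNReal.ofReal (√(A * B) * ‖a‖) ^ 2 := by
        rw [← ENNReal.ofReal_pow (norm_nonneg _), ← ENNReal.ofReal_mul hB0,
          ← ENNReal.ofReal_mul hA0, ← ENNReal.ofReal_pow (by positivity), mul_pow,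
          Real.sq_sqrt (by positivity), mul_assoc]

theorem exists_synthesis {α β : ℝ} {φ : ℝ → ℂ} (hα : 0 < α) (hβ : 0 < β)
    (hφ : MemW0 φ) :
    ∃ T : ell2AP →L[ℂ] AP2, ∀ (a : ell2AP) (lam : ℝ),
      HasSum (fun l : ℤ => φ (lam - l * β) * coeffSeq (a l) (lam * α)) (coeffAP2 (T a) lam) := by
  obtain ⟨K, hK0, hK⟩ := exists_bound_synthesis hα hβ hφ
  set c : ell2AP → ℝ → ℂ := fun a lam => ∑' l : ℤ, φ (lam - l * β) * coeffSeq (a l) (lam * α)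
    with hc
  have hsum := fun (a : ell2AP) (lam : ℝ) => summable_synthesis (α := α) hβ hφ a lam
  have hmem : ∀ a, Memℓp (c a) 2 := fun a =>
    memℓp_gen' (C := (K * ‖a‖) ^ 2) fun s => by simpa using hK a s
  set L : ell2AP →ₗ[ℂ] lp (fun _ : ℝ => ℂ) 2 :=
    { toFun := fun a => ⟨c a, hmem a⟩
      map_add' := fun a b => by
        ext lam
        change c (a + b) lam = c a lam + c b lam
        simp only [hc]
        rw [← (hsum a lam).tsum_add (hsum b lam)]
        refine tsum_congr fun l => ?_
        rw [← mul_add, coeffSeq, coeffSeq, coeffSeq, ← inner_add_right]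
        rfl
      map_smul' := fun z a => by
        ext lam
        change c (z • a) lam = z * c a lam
        simp only [hc]
        rw [← tsum_mul_left]
        refine tsum_congr fun l => ?_
        rw [mul_left_comm z, coeffSeq, coeffSeq, ← inner_smul_right _ _ z]
        rfl } with hL
  have hLc : ∀ a lam, L a lam = c a lam := fun _ _ => rfl
  have hbound : ∀ a, ‖L a‖ ≤ K * ‖a‖ := fun a =>
    lp.norm_le_of_forall_sum_le (by simp) (by positivity) fun s => by simpa [hLc] using hK a s
  refine ⟨apBasis.repr.symm.toContinuousLinearEquiv.toContinuousLinearMap ∘L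
    L.mkContinuous K hbound, fun a lam => ?_⟩
  have h1 : coeffAP2 (apBasis.repr.symm (L a)) lam = c a lam := by
    rw [← apBasis_repr_apply, LinearIsometryEquiv.apply_symm_apply, hLc]
  change HasSum _ (coeffAP2 (apBasis.repr.symm (L a)) lam)
  rw [h1]
  exact (hsum a lam).hasSum

theorem eq_of_coeffAP2_eq {g h : AP2} (H : ∀ lam, coeffAP2 g lam = coeffAP2 h lam) : g = h := by
  refine apBasis.repr.injective (lp.ext (funext fun lam => ?_))
  rw [apBasis_repr_apply, apBasis_repr_apply, H]

/-! ### The analysis operator -/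

theorem pairing_translation (f χ : ℝ → ℂ) (x : ℝ) :
    pairing f (translation x χ) = ∫ u, f (u + x) * conj (χ u) := by
  rw [pairing, ← integral_add_right_eq_self _ x]
  simp only [translation, add_sub_cancel_right]

theorem integrable_translate_mul_conj (f : APFun) {χ : ℝ → ℂ} (hχ : Integrable χ) (x : ℝ) :
    Integrable fun u => f (u + x) * conj (χ u) := by
  obtain ⟨B, _, hB⟩ := f.isAP.orbitTB.bounded
  have hχ' : Integrable fun u => conj (χ u) :=
    (Complex.conjCLE : ℂ →L[ℝ] ℂ).integrable_comp hχ
  exact hχ'.bdd_mul (f.isAP.translate x).1.aestronglyMeasurable (Eventually.of_forall fun u => hB _)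

theorem norm_pairing_sub_le (f g : APFun) {χ : ℝ → ℂ} (hχ : Integrable χ) {x y ε : ℝ}
    (h : ∀ u, ‖f (u + x) - g (u + y)‖ ≤ ε) :
    ‖pairing f (translation x χ) - pairing g (translation y χ)‖ ≤ ε * ∫ u, ‖χ u‖ := by
  rw [pairing_translation, pairing_translation,
    ← integral_sub (integrable_translate_mul_conj f hχ x) (integrable_translate_mul_conj g hχ y),
    ← integral_const_mul]
  refine norm_integral_le_of_norm_le (hχ.norm.const_mul ε) (Eventually.of_forall fun u => ?_)
  rw [← sub_mul, norm_mul, RCLike.norm_conj]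
  gcongr
  exact h u

theorem isAPSeq_pairing (f : APFun) {χ : ℝ → ℂ} (hχ : Integrable χ) (α : ℝ) :
    IsAPSeq fun k => pairing f (translation (α * k) χ) := by
  classical
  refine isAPSeq_of_orbitTB fun ε hε => ?_
  set I : ℝ := ∫ u, ‖χ u‖ with hI
  have hI0 : 0 ≤ I := integral_nonneg fun u => norm_nonneg _
  obtain ⟨s, hs⟩ := f.isAP.orbitTB (ε / (2 * (I + 1))) (by positivity)
  choose i his hi using fun a : ℤ => hs (α * a)
  -- integers whose translates are close to the same element of `s` share a representative
  have hfin : (range i).Finite := s.finite_toSet.subset (by rintro _ ⟨a, rfl⟩; exact his a)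
  refine ⟨hfin.toFinset.image (Function.invFun i), fun a => ⟨Function.invFun i (i a),
    Finset.mem_image_of_mem _ (by simp), fun x => ?_⟩⟩
  set b := Function.invFun i (i a) with hb
  have hib : i b = i a := Function.invFun_eq ⟨a, rfl⟩
  refine (norm_pairing_sub_le f f hχ (ε := ε / (I + 1)) fun u => ?_).trans ?_
  · have e1 := hi a (u + α * x)
    have e2 := hi b (u + α * x)
    rw [hib] at e2
    push_cast
    rw [mul_add, mul_add, ← add_assoc, ← add_assoc]
    calc _ = ‖(f (u + α * x + α * a) - f (u + α * x + i a))
          - (f (u + α * x + α * b) - f (u + α * x + i a))‖ := by congr 1; ring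
      _ ≤ _ := norm_sub_le _ _
      _ ≤ ε / (2 * (I + 1)) + ε / (2 * (I + 1)) := add_le_add e1 e2
      _ = ε / (I + 1) := by field_simp; ring
  · rw [div_mul_eq_mul_div, div_le_iff₀ (by positivity)]
    nlinarith

/-- The map sending `f` to the sequence `⟨f, T_{αk} χ⟩`, `k ∈ ℤ`. -/
def sampleL {χ : ℝ → ℂ} (hχ : Integrable χ) (α : ℝ) : APFun →ₗ[ℂ] APSeq where
  toFun f := ⟨fun k => pairing f (translation (α * k) χ), isAPSeq_pairing f hχ α⟩
  map_add' f g := APSeq.ext fun k => by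
    change pairing (f + g : APFun) _ = pairing f _ + pairing g _
    simp only [pairing_translation, APFun.add_apply, add_mul]
    exact integral_add (integrable_translate_mul_conj f hχ _) (integrable_translate_mul_conj g hχ _)
  map_smul' c f := APSeq.ext fun k => by
    change pairing (c • f : APFun) _ = c * pairing f _
    simp only [pairing_translation, APFun.smul_apply, mul_assoc]
    exact integral_const_mul _ _

theorem sampleL_apply {χ : ℝ → ℂ} (hχ : Integrable χ) (α : ℝ) (f : APFun) (k : ℤ) :
    sampleL hχ α f k = pairing f (translation (α * k) χ) := rfl

theorem norm_sampleL_sub_le {χ : ℝ → ℂ} (hχ : Integrable χ) (α : ℝ) {f g : APFun} {ε : ℝ}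
    (h : ∀ t, ‖f t - g t‖ ≤ ε) :
    ‖sampleL hχ α f - sampleL hχ α g‖ ≤ ε * ∫ u, ‖χ u‖ :=
  APSeq.norm_le fun _ => norm_pairing_sub_le f g hχ fun _ => h _

theorem integrable_modulation {ψ : ℝ → ℂ} (hψ : Integrable ψ) (ω : ℝ) :
    Integrable (modulation ω ψ) :=
  hψ.bdd_mul (c := 1) (Continuous.aestronglyMeasurable (by fun_prop))
    (Eventually.of_forall fun t => (Complex.norm_exp_I_mul_ofReal _).le)

theorem sampleL_modulation_expFun {ψ : ℝ → ℂ} (hψ : Integrable ψ) (α ω lam : ℝ) :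
    sampleL (integrable_modulation hψ ω) α (expFun lam)
      = conj (fourierL1 ψ (lam - ω)) • expSeq (lam * α) := by
  refine APSeq.ext fun k => ?_
  rw [sampleL_apply, pairing_translation, APSeq.smul_apply, fourierL1, ← integral_conj,
    ← integral_mul_const]
  refine integral_congr_ae (Eventually.of_forall fun u => ?_)
  simp only [modulation, expFun_apply, expSeq_apply, map_mul, ← Complex.exp_conj, map_neg,
    Complex.conj_I, Complex.conj_ofReal]
  rw [← mul_assoc, ← Complex.exp_add, mul_comm, mul_assoc, ← Complex.exp_add]
  congr 2
  push_cast; ring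

theorem coeffAP2_synthesis_single {α β : ℝ} {ψ : ℝ → ℂ} {T : ell2AP →L[ℂ] AP2}
    (hT : ∀ (a : ell2AP) (lam : ℝ),
      HasSum (fun l : ℤ => fourierL1 ψ (lam - l * β) * coeffSeq (a l) (lam * α))
        (coeffAP2 (T a) lam))
    (l : ℤ) (a : APSeq) (lam : ℝ) :
    coeffAP2 (T (lp.single 2 l a)) lam
      = fourierL1 ψ (lam - l * β) * coeffSeq a (lam * α) := by
  refine (hT _ lam).unique ?_
  have h := hasSum_single (f := fun j : ℤ => fourierL1 ψ (lam - j * β)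
    * coeffSeq ((lp.single 2 l a : ell2AP) j) (lam * α)) l fun j hj => by
      have hne : (lp.single 2 l a : ell2AP) j = 0 :=
        lp.single_apply_ne (E := fun _ : ℤ => APSeq) 2 l a hj
      refine (congrArg (fun z => fourierL1 ψ (lam - j * β) * coeffSeq z (lam * α)) hne).trans ?_
      rw [coeffSeq, inner_zero_right, mul_zero]
  simpa only [lp.single_apply_self] using h

/-- On trigonometric polynomials the analysis operator is the adjoint of the synthesis operator. -/
theorem inner_sampleL_modulation {α β : ℝ} {ψ : ℝ → ℂ} (hψ : Integrable ψ) {T : ell2AP →L[ℂ] AP2}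
    (hT : ∀ (a : ell2AP) (lam : ℝ),
      HasSum (fun l : ℤ => fourierL1 ψ (lam - l * β) * coeffSeq (a l) (lam * α))
        (coeffAP2 (T a) lam))
    (l : ℤ) (a : APSeq) {p : APFun} (hp : p ∈ trigPoly) :
    inner ℂ a (sampleL (integrable_modulation hψ (β * l)) α p)
      = inner ℂ (T (lp.single 2 l a)) (p : AP2) := by
  induction hp using Submodule.span_induction with
  | mem x hx =>
    obtain ⟨lam, rfl⟩ := hx
    have h1 := coeffAP2_synthesis_single hT l a lam
    rw [sampleL_modulation_expFun hψ, inner_smul_right, ← inner_conj_symm a,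
      ← inner_conj_symm (T _), ← map_mul]
    rw [coeffAP2, coeffSeq] at h1
    rw [h1, mul_comm β]
  | zero => rw [map_zero, inner_zero_right, UniformSpace.Completion.coe_zero, inner_zero_right]
  | add x y _ _ hx hy =>
    rw [map_add, inner_add_right, UniformSpace.Completion.coe_add, inner_add_right, hx, hy]
  | smul c x _ hx =>
    rw [map_smul, inner_smul_right, UniformSpace.Completion.coe_smul, inner_smul_right, hx]

/-- Testing the adjoint relation on the truncated family of samples itself bounds its energy. -/
theorem sum_norm_sq_sampleL_le_of_mem_trigPoly
    {α β : ℝ} {ψ : ℝ → ℂ} (hψ : Integrable ψ) {T : ell2AP →L[ℂ] AP2}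
    (hT : ∀ (a : ell2AP) (lam : ℝ),
      HasSum (fun l : ℤ => fourierL1 ψ (lam - l * β) * coeffSeq (a l) (lam * α))
        (coeffAP2 (T a) lam))
    (s : Finset ℤ) {p : APFun} (hp : p ∈ trigPoly) :
    ∑ l ∈ s, ‖sampleL (integrable_modulation hψ (β * l)) α p‖ ^ 2 ≤ ‖T‖ ^ 2 * ‖p‖ ^ 2 := by
  set b : ℤ → APSeq := fun l => sampleL (integrable_modulation hψ (β * l)) α p with hb
  set a : ell2AP := ∑ l ∈ s, lp.single 2 l (b l) with ha
  set E : ℝ := ∑ l ∈ s, ‖b l‖ ^ 2 with hE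
  have hE0 : 0 ≤ E := Finset.sum_nonneg fun _ _ => by positivity
  have hna : ‖a‖ ^ 2 = E := by
    have := lp.norm_sum_single (p := 2) (by simp) b s
    simpa using this
  -- the energy is the inner product of `T a` with `p`
  have h1 : ((E : ℝ) : ℂ) = inner ℂ (T a) (p : AP2) := by
    rw [ha, map_sum, sum_inner, hE, Complex.ofReal_sum]
    refine Finset.sum_congr rfl fun l _ => ?_
    rw [← inner_sampleL_modulation hψ hT l (b l) hp]
    change _ = inner ℂ (b l) (b l)
    rw [inner_self_eq_norm_sq_to_K]
    push_cast; rfl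
  have h2 : E ≤ ‖T‖ * ‖a‖ * ‖p‖ := by
    have h3 := norm_inner_le_norm (𝕜 := ℂ) (T a) (p : AP2)
    rw [← h1, Complex.norm_real, Real.norm_of_nonneg hE0, UniformSpace.Completion.norm_coe] at h3
    exact h3.trans (by gcongr; exact T.le_opNorm a)
  have h4 : E ^ 2 ≤ ‖T‖ ^ 2 * ‖p‖ ^ 2 * E := by
    calc E ^ 2 ≤ (‖T‖ * ‖a‖ * ‖p‖) ^ 2 := by gcongr
      _ = _ := by rw [← hna]; ring
  rcases hE0.eq_or_lt with h0 | h0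
  · rw [← h0]; positivity
  · rw [sq] at h4
    exact le_of_mul_le_mul_right h4 h0

theorem sum_norm_sq_sampleL_le {α β : ℝ} {ψ : ℝ → ℂ} (hψ : Integrable ψ) {T : ell2AP →L[ℂ] AP2}
    (hT : ∀ (a : ell2AP) (lam : ℝ),
      HasSum (fun l : ℤ => fourierL1 ψ (lam - l * β) * coeffSeq (a l) (lam * α))
        (coeffAP2 (T a) lam))
    (s : Finset ℤ) (f : APFun) :
    ∑ l ∈ s, ‖sampleL (integrable_modulation hψ (β * l)) α f‖ ^ 2 ≤ ‖T‖ ^ 2 * ‖f‖ ^ 2 := by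
  choose p hp hfp using fun n : ℕ =>
    exists_trigPoly_uniform f (ε := 1 / ((n : ℝ) + 1)) (by positivity)
  have hlim := tendsto_one_div_add_atTop_nhds_zero_nat (𝕜 := ℝ)
  have hpf : Tendsto (fun n => p n) atTop (𝓝 f) := by
    refine tendsto_iff_norm_sub_tendsto_zero.mpr (squeeze_zero (fun _ => norm_nonneg _)
      (fun n => ?_) hlim)
    rw [norm_sub_rev]
    exact APFun.norm_le (hfp n)
  have hS : ∀ l : ℤ, Tendsto (fun n => sampleL (integrable_modulation hψ (β * l)) α (p n)) atTop
      (𝓝 (sampleL (integrable_modulation hψ (β * l)) α f)) := by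
    intro l
    have hlim' := hlim.mul_const (∫ u, ‖modulation (β * l) ψ u‖)
    rw [zero_mul] at hlim'
    refine tendsto_iff_norm_sub_tendsto_zero.mpr (squeeze_zero (fun _ => norm_nonneg _)
      (fun n => ?_) hlim')
    rw [norm_sub_rev]
    exact norm_sampleL_sub_le _ α (hfp n)
  exact le_of_tendsto_of_tendsto' (tendsto_finsetSum s fun l _ => (hS l).norm.pow 2)
    ((hpf.norm.pow 2).const_mul _)
    fun n => sum_norm_sq_sampleL_le_of_mem_trigPoly hψ hT s (hp n)

end APGabor

end

open APGabor
theorem mainTheorem4 (α β : ℝ) (hα : 0 < α) (hβ : 0 < β) (ψ : ℝ → ℂ)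
    (hψ : MeasureTheory.Integrable ψ) (hψW : MemW0 (fourierL1 ψ)) :
    (∃ T : ell2AP →L[ℂ] AP2,
      (∀ (a : ell2AP) (lam : ℝ),
        HasSum (fun l : ℤ => fourierL1 ψ (lam - l * β) * coeffSeq (a l) (lam * α))
          (coeffAP2 (T a) lam)) ∧
      (∀ (a : ell2AP) (g : AP2),
        (∀ lam : ℝ, HasSum (fun l : ℤ => fourierL1 ψ (lam - l * β) * coeffSeq (a l) (lam * α))
          (coeffAP2 g lam)) → g = T a)) ∧
    (∃ C : ℝ, ∀ f : APFun, ∃ s : ℤ → APSeq,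
      (∀ l k : ℤ, s l k = pairing f (translation (α * k) (modulation (β * l) ψ))) ∧
      Summable (fun l : ℤ => ‖s l‖ ^ 2) ∧
      ∑' l : ℤ, ‖s l‖ ^ 2 ≤ C * ‖f‖ ^ 2) := by
  obtain ⟨T, hT⟩ := exists_synthesis hα hβ hψW
  refine ⟨⟨T, hT, fun a g hg => eq_of_coeffAP2_eq fun lam => (hg lam).unique (hT a lam)⟩,
    ‖T‖ ^ 2, fun f => ⟨fun l => sampleL (integrable_modulation hψ (β * l)) α f,
      fun l k => rfl, ?_, ?_⟩⟩
  · exact summable_of_sum_le (fun _ => by positivity) fun s => sum_norm_sq_sampleL_le hψ hT s f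
  · exact Real.tsum_le_of_sum_le (fun _ => by positivity) fun s => sum_norm_sq_sampleL_le hψ hT s f
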